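/- Let $k$ be a field. A tensorial category over $k$ is an abelian $k$-linear category with a symmetric monoidal structure (a tensor category) such that $\otimes$ is $k$-bilinear, every object has a dual, and $k\to\mathrm{End}(\mathbb 1)$ is an isomorphism. For a commutative $k$-algebra $R$, an $R$-valued fibre functor on it is an exact $k$-linear tensor functor (i.e. symmetric strong monoidal functor) to $\mathrm{Mod}(R)$. A tannakian category over $k$ is a tensorial category over $k$ that admits an $R$-valued fibre functor for some nonzero commutative $k$-algebra $R$. **Theorem.** Let $\mathsf C$ be an essentially small tannakian category over $k$ and let $\omega$ be a $k$-valued fibre functor on $\mathsf C$. For a commutative $k$-algebra $R$, let $\omega\otimes R$ be the functor $X\mapsto R\otimes_k\omega(X)$, with the tensor structure obtained from that of $\omega$ by base change, and let $\mathrm{Aut}^\otimes(\omega\otimes R)$ be the group of its automorphisms as a tensor functor. (a) The functor $R\rightsquigarrow\mathrm{Aut}^\otimes(\omega\otimes R)$ from commutative $k$-algebras to groups is represented by an affine group scheme over $k$: there is an affine group scheme $G$ over $k$ with isomorphisms of groups $G(R)\simeq\mathrm{Aut}^\otimes(\omega\otimes R)$, natural in $R$. (b) Let $G$ be any affine group scheme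 over $k$ equipped with such a natural isomorphism. Then $G(R)$ acts on $R\otimes_k\omega(X)$ for every object $X$ and every $R$, the vector space $\omega(X)$ is finite-dimensional, and the resulting functor $X\mapsto\omega(X)$ from $\mathsf C$ to the tensor category $\mathsf{Repf}(G)$ of finite-dimensional representations of $G$ over $k$, with the tensor structure given by that of $\omega$, is an equivalence of tensor categories. -/

import Mathlib

open CategoryTheory MonoidalCategory TensorProduct

universe u v w

namespace NeutralTannaka

noncomputable section

section LinearAlgebra

variable {k : Type u} [CommRing k]

/-- The map `f ⊗ V : R ⊗ V → S ⊗ V` attached to a homomorphism `f : R → S` of `k`-algebras. -/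
def scalarMap {R S : Type u} [CommRing R] [CommRing S] [Algebra k R] [Algebra k S]
    (f : R →ₐ[k] S) (V : Type u) [AddCommGroup V] [Module k V] :
    R ⊗[k] V →ₗ[k] S ⊗[k] V :=
  LinearMap.rTensor V f.toLinearMap

/-- The base change along `f : R → S` of an `R`-linear endomorphism `a` of `R ⊗ V`: it is the
`S`-linear endomorphism of `S ⊗ V` with `1 ⊗ v ↦ (f ⊗ V) (a (1 ⊗ v))`. -/
def extEnd {R S : Type u} [CommRing R] [CommRing S] [Algebra k R] [Algebra k S]
    (f : R →ₐ[k] S) {V : Type u} [AddCommGroup V] [Module k V]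
    (a : Module.End R (R ⊗[k] V)) : Module.End S (S ⊗[k] V) :=
  LinearMap.liftBaseChange S
    (scalarMap f V ∘ₗ a.restrictScalars k ∘ₗ TensorProduct.mk k R V 1)

/-- For `a` an `R`-linear endomorphism of `R ⊗ V` and `b` one of `R ⊗ W`, the endomorphism
`a ⊗ b` of `R ⊗ (V ⊗ W) ≃ (R ⊗ V) ⊗_R (R ⊗ W)`. -/
def tensorEnd {R : Type u} [CommRing R] [Algebra k R] {V W : Type u} [AddCommGroup V]
    [Module k V] [AddCommGroup W] [Module k W]
    (a : Module.End R (R ⊗[k] V)) (b : Module.End R (R ⊗[k] W)) :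
    Module.End R (R ⊗[k] (V ⊗[k] W)) :=
  (AlgebraTensorModule.distribBaseChange k R V W).symm.toLinearMap ∘ₗ
    TensorProduct.map a b ∘ₗ (AlgebraTensorModule.distribBaseChange k R V W).toLinearMap

variable {R S T : Type u} [CommRing R] [CommRing S] [CommRing T]
  [Algebra k R] [Algebra k S] [Algebra k T]
variable {V W U V' W' : Type u} [AddCommGroup V] [Module k V] [AddCommGroup W] [Module k W]
  [AddCommGroup U] [Module k U] [AddCommGroup V'] [Module k V'] [AddCommGroup W'] [Module k W']

@[simp]
lemma scalarMap_tmul (f : R →ₐ[k] S) (r : R) (x : V) :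
    scalarMap f V (r ⊗ₜ[k] x) = f r ⊗ₜ[k] x := rfl

lemma scalarMap_smul (f : R →ₐ[k] S) (r : R) (x : R ⊗[k] V) :
    scalarMap f V (r • x) = f r • scalarMap f V x := by
  induction x with
  | zero => simp
  | tmul a x => simp [TensorProduct.smul_tmul']
  | add x y hx hy => simp [hx, hy]

lemma scalarMap_id (x : R ⊗[k] V) : scalarMap (AlgHom.id k R) V x = x := by
  induction x with
  | zero => simp
  | tmul a x => simp
  | add x y hx hy => simp [hx, hy]

lemma scalarMap_comp (f : R →ₐ[k] S) (g : S →ₐ[k] T) (x : R ⊗[k] V) :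
    scalarMap (g.comp f) V x = scalarMap g V (scalarMap f V x) := by
  induction x with
  | zero => simp
  | tmul a x => simp
  | add x y hx hy => simp [hx, hy]

lemma scalarMap_baseChange (f : R →ₐ[k] S) (h : V →ₗ[k] W) (x : R ⊗[k] V) :
    scalarMap f W (h.baseChange R x) = h.baseChange S (scalarMap f V x) := by
  induction x with
  | zero => simp
  | tmul a x => simp
  | add x y hx hy => simp [hx, hy]

lemma extEnd_scalarMap (f : R →ₐ[k] S) (a : Module.End R (R ⊗[k] V)) (x : R ⊗[k] V) :
    extEnd f a (scalarMap f V x) = scalarMap f V (a x) := by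
  induction x with
  | zero => simp
  | tmul r x =>
    have : r ⊗ₜ[k] x = r • ((1 : R) ⊗ₜ[k] x) := by simp [TensorProduct.smul_tmul']
    rw [this, scalarMap_smul, map_smul, map_smul, scalarMap_smul]
    simp [extEnd]
  | add x y hx hy => simp [hx, hy]

lemma hom_ext_scalarMap (f : R →ₐ[k] S) {M : Type u} [AddCommGroup M] [Module S M]
    {a b : S ⊗[k] V →ₗ[S] M}
    (h : ∀ x, a (scalarMap f V x) = b (scalarMap f V x)) : a = b := by
  refine LinearMap.ext fun z ↦ ?_
  induction z with
  | zero => simp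
  | add x y hx hy => rw [map_add, map_add, hx, hy]
  | tmul s x =>
    have : s ⊗ₜ[k] x = s • scalarMap f V (1 ⊗ₜ[k] x) := by simp [TensorProduct.smul_tmul']
    rw [this, map_smul, map_smul, h]

lemma extEnd_unique (f : R →ₐ[k] S) (a : Module.End R (R ⊗[k] V)) (b : Module.End S (S ⊗[k] V))
    (h : ∀ x, b (scalarMap f V x) = scalarMap f V (a x)) : extEnd f a = b :=
  hom_ext_scalarMap f fun x ↦ by rw [extEnd_scalarMap, h]

/-- Base change of endomorphisms, as a homomorphism of monoids. -/
def extEndHom (f : R →ₐ[k] S) (V : Type u) [AddCommGroup V] [Module k V] :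
    Module.End R (R ⊗[k] V) →* Module.End S (S ⊗[k] V) where
  toFun := extEnd f
  map_one' := extEnd_unique f _ _ fun _ ↦ rfl
  map_mul' a b := extEnd_unique f _ _ fun x ↦ by
    simp [Module.End.mul_apply, extEnd_scalarMap]

lemma comm_mul {h : R ⊗[k] V →ₗ[R] R ⊗[k] W} {a a' : Module.End R (R ⊗[k] W)}
    {b b' : Module.End R (R ⊗[k] V)} (hab : a ∘ₗ h = h ∘ₗ b) (hab' : a' ∘ₗ h = h ∘ₗ b') :
    (a * a') ∘ₗ h = h ∘ₗ (b * b') := by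
  rw [Module.End.mul_eq_comp, Module.End.mul_eq_comp, LinearMap.comp_assoc, hab',
    ← LinearMap.comp_assoc, hab, LinearMap.comp_assoc]

lemma comm_inv {h : R ⊗[k] V →ₗ[R] R ⊗[k] W} {a : (Module.End R (R ⊗[k] W))ˣ}
    {b : (Module.End R (R ⊗[k] V))ˣ} (hab : a.val ∘ₗ h = h ∘ₗ b.val) :
    (a⁻¹).val ∘ₗ h = h ∘ₗ (b⁻¹).val := by
  have h1 : (a⁻¹).val ∘ₗ a.val = LinearMap.id := a.inv_mul
  have h2 : b.val ∘ₗ (b⁻¹).val = LinearMap.id := b.mul_inv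
  calc (a⁻¹).val ∘ₗ h = (a⁻¹).val ∘ₗ (h ∘ₗ b.val) ∘ₗ (b⁻¹).val := by
        rw [LinearMap.comp_assoc, h2, LinearMap.comp_id]
    _ = h ∘ₗ (b⁻¹).val := by
        rw [← hab, ← LinearMap.comp_assoc, ← LinearMap.comp_assoc, h1, LinearMap.id_comp]

lemma extEnd_id (a : Module.End R (R ⊗[k] V)) : extEnd (AlgHom.id k R) a = a :=
  extEnd_unique _ _ _ fun x ↦ by simp [scalarMap_id]

lemma extEnd_comp (f : R →ₐ[k] S) (g : S →ₐ[k] T) (a : Module.End R (R ⊗[k] V)) :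
    extEnd (g.comp f) a = extEnd g (extEnd f a) :=
  extEnd_unique _ _ _ fun x ↦ by simp [scalarMap_comp, extEnd_scalarMap]

lemma extEnd_comm_baseChange (f : R →ₐ[k] S) (h : V →ₗ[k] W) {a : Module.End R (R ⊗[k] V)}
    {b : Module.End R (R ⊗[k] W)} (hab : b ∘ₗ h.baseChange R = h.baseChange R ∘ₗ a) :
    extEnd f b ∘ₗ h.baseChange S = h.baseChange S ∘ₗ extEnd f a :=
  hom_ext_scalarMap f fun x ↦ by
    have := LinearMap.congr_fun hab x
    simp only [LinearMap.comp_apply] at this ⊢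
    rw [← scalarMap_baseChange, extEnd_scalarMap, this, extEnd_scalarMap, scalarMap_baseChange]

/-- The multiplication `(R ⊗ V) × (R ⊗ W) → R ⊗ (V ⊗ W)`. -/
def tmulR (x : R ⊗[k] V) (y : R ⊗[k] W) : R ⊗[k] (V ⊗[k] W) :=
  (AlgebraTensorModule.distribBaseChange k R V W).symm (x ⊗ₜ[R] y)

@[simp]
lemma tmulR_tmul (r s : R) (x : V) (y : W) :
    tmulR (r ⊗ₜ[k] x) (s ⊗ₜ[k] y) = (r * s) ⊗ₜ[k] (x ⊗ₜ[k] y) := by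
  simp [tmulR]

@[simp] lemma tmulR_zero (x : R ⊗[k] V) : tmulR x (0 : R ⊗[k] W) = 0 := by simp [tmulR]
@[simp] lemma zero_tmulR (y : R ⊗[k] W) : tmulR (0 : R ⊗[k] V) y = 0 := by simp [tmulR]
lemma tmulR_add (x : R ⊗[k] V) (y z : R ⊗[k] W) : tmulR x (y + z) = tmulR x y + tmulR x z := by
  simp [tmulR, TensorProduct.tmul_add]
lemma add_tmulR (x y : R ⊗[k] V) (z : R ⊗[k] W) : tmulR (x + y) z = tmulR x z + tmulR y z := by
  simp [tmulR, TensorProduct.add_tmul]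

lemma tensorEnd_tmulR (a : Module.End R (R ⊗[k] V)) (b : Module.End R (R ⊗[k] W))
    (x : R ⊗[k] V) (y : R ⊗[k] W) : tensorEnd a b (tmulR x y) = tmulR (a x) (b y) := by
  simp [tensorEnd, tmulR]

lemma hom_ext_tmulR {M : Type u} [AddCommGroup M] [Module R M]
    {a b : R ⊗[k] (V ⊗[k] W) →ₗ[R] M}
    (h : ∀ (x : R ⊗[k] V) (y : R ⊗[k] W), a (tmulR x y) = b (tmulR x y)) : a = b := by
  refine LinearMap.ext fun z ↦ ?_
  induction z with
  | zero => simp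
  | add x y hx hy => rw [map_add, map_add, hx, hy]
  | tmul r z =>
    induction z with
    | zero => simp
    | add x y hx hy => rw [TensorProduct.tmul_add, map_add, map_add, hx, hy]
    | tmul x y => simpa using h (r ⊗ₜ x) (1 ⊗ₜ y)

lemma scalarMap_tmulR (f : R →ₐ[k] S) (x : R ⊗[k] V) (y : R ⊗[k] W) :
    scalarMap f (V ⊗[k] W) (tmulR x y) = tmulR (scalarMap f V x) (scalarMap f W y) := by
  induction x with
  | zero => simp
  | add x x' hx hx' => simp [add_tmulR, hx, hx']
  | tmul r x =>
    induction y with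
    | zero => simp
    | add y y' hy hy' => simp only [tmulR_add, map_add, hy, hy']
    | tmul s y => simp

lemma extEnd_tensorEnd (f : R →ₐ[k] S) (a : Module.End R (R ⊗[k] V))
    (b : Module.End R (R ⊗[k] W)) :
    extEnd f (tensorEnd a b) = tensorEnd (extEnd f a) (extEnd f b) :=
  extEnd_unique _ _ _ fun z ↦ by
    induction z with
    | zero => simp
    | add x y hx hy => simp only [map_add, hx, hy]
    | tmul r z =>
      induction z with
      | zero => simp
      | add x y hx hy => simp only [TensorProduct.tmul_add, map_add, hx, hy]
      | tmul x y =>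
        have : r ⊗ₜ[k] (x ⊗ₜ[k] y) = tmulR (r ⊗ₜ[k] x) ((1 : R) ⊗ₜ[k] y) := by simp
        rw [this, scalarMap_tmulR, tensorEnd_tmulR, tensorEnd_tmulR, extEnd_scalarMap,
          extEnd_scalarMap, scalarMap_tmulR]

/-- The tensor product of endomorphisms, as a homomorphism of monoids. -/
def tensorEndHom (R : Type u) [CommRing R] [Algebra k R] (V W : Type u) [AddCommGroup V]
    [Module k V] [AddCommGroup W] [Module k W] :
    Module.End R (R ⊗[k] V) × Module.End R (R ⊗[k] W) →* Module.End R (R ⊗[k] (V ⊗[k] W)) where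
  toFun p := tensorEnd p.1 p.2
  map_one' := hom_ext_tmulR fun x y ↦ by simp [tensorEnd_tmulR]
  map_mul' p q := hom_ext_tmulR fun x y ↦ by simp [tensorEnd_tmulR, Module.End.mul_apply]

lemma baseChange_tmulR (h : V →ₗ[k] V') (g : W →ₗ[k] W') (x : R ⊗[k] V) (y : R ⊗[k] W) :
    (TensorProduct.map h g).baseChange R (tmulR x y) =
      tmulR (h.baseChange R x) (g.baseChange R y) := by
  induction x with
  | zero => simp
  | add x x' hx hx' => simp only [add_tmulR, map_add, hx, hx']
  | tmul r x =>
    induction y with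
    | zero => simp
    | add y y' hy hy' => simp only [tmulR_add, map_add, hy, hy']
    | tmul s y => simp

lemma tensorEnd_comm_baseChange (h : V →ₗ[k] V') (g : W →ₗ[k] W')
    {a : Module.End R (R ⊗[k] V)} {a' : Module.End R (R ⊗[k] V')}
    {b : Module.End R (R ⊗[k] W)} {b' : Module.End R (R ⊗[k] W')}
    (ha : a' ∘ₗ h.baseChange R = h.baseChange R ∘ₗ a)
    (hb : b' ∘ₗ g.baseChange R = g.baseChange R ∘ₗ b) :
    tensorEnd a' b' ∘ₗ (TensorProduct.map h g).baseChange R =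
      (TensorProduct.map h g).baseChange R ∘ₗ tensorEnd a b :=
  hom_ext_tmulR fun x y ↦ by
    have ha := LinearMap.congr_fun ha x
    have hb := LinearMap.congr_fun hb y
    simp only [LinearMap.comp_apply] at ha hb ⊢
    rw [baseChange_tmulR, tensorEnd_tmulR, tensorEnd_tmulR, baseChange_tmulR, ha, hb]

lemma assoc_tmulR (x : R ⊗[k] V) (y : R ⊗[k] W) (z : R ⊗[k] U) :
    (TensorProduct.assoc k V W U).toLinearMap.baseChange R (tmulR (tmulR x y) z) =
      tmulR x (tmulR y z) := by
  induction x with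
  | zero => simp
  | add x x' hx hx' => simp only [add_tmulR, map_add, hx, hx']
  | tmul r x =>
    induction y with
    | zero => simp
    | add y y' hy hy' => simp only [tmulR_add, add_tmulR, map_add, hy, hy']
    | tmul s y =>
      induction z with
      | zero => simp
      | add z z' hz hz' => simp only [tmulR_add, map_add, hz, hz']
      | tmul t z => simp [mul_assoc]

lemma comm_tmulR (x : R ⊗[k] V) (y : R ⊗[k] W) :
    (TensorProduct.comm k V W).toLinearMap.baseChange R (tmulR x y) = tmulR y x := by
  induction x with
  | zero => simp
  | add x x' hx hx' => simp only [add_tmulR, tmulR_add, map_add, hx, hx']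
  | tmul r x =>
    induction y with
    | zero => simp
    | add y y' hy hy' => simp only [tmulR_add, add_tmulR, map_add, hy, hy']
    | tmul s y => simp [mul_comm]

lemma tensorEnd_assoc (a : Module.End R (R ⊗[k] V)) (b : Module.End R (R ⊗[k] W))
    (c : Module.End R (R ⊗[k] U)) :
    tensorEnd a (tensorEnd b c) ∘ₗ (TensorProduct.assoc k V W U).toLinearMap.baseChange R =
      (TensorProduct.assoc k V W U).toLinearMap.baseChange R ∘ₗ tensorEnd (tensorEnd a b) c := by
  ext x y z
  have : (1 : R) ⊗ₜ[k] ((x ⊗ₜ[k] y) ⊗ₜ[k] z) =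
      tmulR (tmulR ((1 : R) ⊗ₜ[k] x) ((1 : R) ⊗ₜ[k] y)) ((1 : R) ⊗ₜ[k] z) := by simp
  simp only [AlgebraTensorModule.curry_apply, TensorProduct.curry_apply, LinearMap.coe_comp,
    LinearMap.coe_restrictScalars, Function.comp_apply, LinearMap.restrictScalars_comp, this,
    assoc_tmulR, tensorEnd_tmulR]

lemma tensorEnd_comm (a : Module.End R (R ⊗[k] V)) (b : Module.End R (R ⊗[k] W)) :
    tensorEnd b a ∘ₗ (TensorProduct.comm k V W).toLinearMap.baseChange R =
      (TensorProduct.comm k V W).toLinearMap.baseChange R ∘ₗ tensorEnd a b :=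
  hom_ext_tmulR fun x y ↦ by simp only [LinearMap.comp_apply, comm_tmulR, tensorEnd_tmulR]

lemma tensorEnd_lid (a : Module.End R (R ⊗[k] V)) :
    a ∘ₗ (TensorProduct.lid k V).toLinearMap.baseChange R =
      (TensorProduct.lid k V).toLinearMap.baseChange R ∘ₗ
        tensorEnd (1 : Module.End R (R ⊗[k] k)) a := by
  have key : ∀ y : R ⊗[k] V, (TensorProduct.lid k V).toLinearMap.baseChange R
      (tmulR ((1 : R) ⊗ₜ[k] (1 : k)) y) = y := fun y ↦ by
    induction y with
    | zero => simp
    | add y y' hy hy' => simp only [tmulR_add, map_add, hy, hy']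
    | tmul s y => simp
  ext y
  have : (1 : R) ⊗ₜ[k] ((1 : k) ⊗ₜ[k] y) = tmulR ((1 : R) ⊗ₜ[k] (1 : k)) ((1 : R) ⊗ₜ[k] y) := by
    simp
  simp only [AlgebraTensorModule.curry_apply, TensorProduct.curry_apply, LinearMap.coe_comp,
    LinearMap.coe_restrictScalars, Function.comp_apply, LinearMap.restrictScalars_comp, this,
    tensorEnd_tmulR, key, Module.End.one_apply]

lemma tensorEnd_rid (a : Module.End R (R ⊗[k] V)) :
    a ∘ₗ (TensorProduct.rid k V).toLinearMap.baseChange R =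
      (TensorProduct.rid k V).toLinearMap.baseChange R ∘ₗ
        tensorEnd a (1 : Module.End R (R ⊗[k] k)) := by
  have key : ∀ y : R ⊗[k] V, (TensorProduct.rid k V).toLinearMap.baseChange R
      (tmulR y ((1 : R) ⊗ₜ[k] (1 : k))) = y := fun y ↦ by
    induction y with
    | zero => simp
    | add y y' hy hy' => simp only [add_tmulR, map_add, hy, hy']
    | tmul s y => simp
  refine hom_ext_tmulR fun x y ↦ ?_
  induction y with
  | zero => simp
  | add y y' hy hy' => simp only [tmulR_add, map_add, hy, hy']
  | tmul s c =>
    have : tmulR x (s ⊗ₜ[k] c) = tmulR ((c • s) • x) ((1 : R) ⊗ₜ[k] (1 : k)) := by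
      have h1 : s ⊗ₜ[k] c = (c • s) • ((1 : R) ⊗ₜ[k] (1 : k)) := by
        rw [TensorProduct.smul_tmul', smul_eq_mul, mul_one, TensorProduct.smul_tmul, smul_eq_mul,
          mul_one]
      rw [h1, tmulR, tmulR, TensorProduct.tmul_smul, TensorProduct.smul_tmul']
    rw [this]
    simp only [LinearMap.comp_apply, tensorEnd_tmulR, key, Module.End.one_apply]

end LinearAlgebra

section Representations

variable {k : Type u} [CommRing k]

/-- The group functor `R ↦ GL_R(R ⊗ V) = Aut_R(R ⊗ V)` on commutative `k`-algebras. -/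
def generalLinear (V : ModuleCat.{u} k) : CommAlgCat.{u} k ⥤ GrpCat.{u} where
  obj R := GrpCat.of (Module.End R (R ⊗[k] V))ˣ
  map f := GrpCat.ofHom (Units.map (extEndHom f.hom V))
  map_id R := by
    ext a : 3
    exact extEnd_id _
  map_comp f g := by
    ext a : 3
    exact extEnd_comp _ _ _

/-- A linear representation of a group functor `F` on a `k`-module `V`: a homomorphism
`F → GL_V`, i.e. an action of `F(R)` on `R ⊗ V` by `R`-linear automorphisms, natural in `R`. -/
structure LinRep (F : CommAlgCat.{u} k ⥤ GrpCat.{u}) where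
  /-- The underlying module. -/
  V : ModuleCat.{u} k
  /-- The action. -/
  ρ : F ⟶ generalLinear V

namespace LinRep

variable {F : CommAlgCat.{u} k ⥤ GrpCat.{u}}

/-- The endomorphism of `R ⊗ V` by which `g ∈ F(R)` acts. -/
def act (X : LinRep F) {R : CommAlgCat.{u} k} (g : F.obj R) : Module.End R (R ⊗[k] X.V) :=
  Units.val (((X.ρ.app R).hom g : (Module.End R (R ⊗[k] X.V))ˣ))

lemma act_map (X : LinRep F) {R S : CommAlgCat.{u} k} (f : R ⟶ S) (g : F.obj R) :
    X.act (F.map f g) = extEnd f.hom (X.act g) :=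
  congrArg Units.val (ConcreteCategory.congr_hom (X.ρ.naturality f) g)

/-- A morphism of representations: a `k`-linear map `h` such that `R ⊗ h` commutes with the
actions of `F(R)`, for all `R`. -/
@[ext]
structure Hom (X Y : LinRep F) where
  /-- The underlying linear map. -/
  hom : X.V ⟶ Y.V
  comm : ∀ {R : CommAlgCat.{u} k} (g : F.obj R),
    Y.act g ∘ₗ hom.hom.baseChange R = hom.hom.baseChange R ∘ₗ X.act g

instance : Category (LinRep F) where
  Hom := Hom
  id X := { hom := 𝟙 X.V, comm := fun g ↦ by simp [LinearMap.comp_id, LinearMap.id_comp] }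
  comp f g :=
    { hom := f.hom ≫ g.hom
      comm := fun a ↦ by
        rw [ModuleCat.hom_comp, LinearMap.baseChange_comp, ← LinearMap.comp_assoc, g.comm,
          LinearMap.comp_assoc, f.comm, LinearMap.comp_assoc] }

@[simp] lemma id_hom (X : LinRep F) : Hom.hom (𝟙 X) = 𝟙 X.V := rfl
@[simp] lemma comp_hom {X Y Z : LinRep F} (f : X ⟶ Y) (g : Y ⟶ Z) :
    Hom.hom (f ≫ g) = Hom.hom f ≫ Hom.hom g := rfl

@[ext]
lemma hom_ext {X Y : LinRep F} {f g : X ⟶ Y} (h : Hom.hom f = Hom.hom g) : f = g := Hom.ext h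

/-- The functor that forgets the action. -/
def forget (F : CommAlgCat.{u} k ⥤ GrpCat.{u}) : LinRep F ⥤ ModuleCat.{u} k where
  obj X := X.V
  map f := Hom.hom f

instance : (forget F).Faithful where
  map_injective h := hom_ext h

/-- An isomorphism of modules that is compatible with the actions is an isomorphism of
representations. -/
@[simps]
def isoMk {X Y : LinRep F} (e : X.V ≅ Y.V)
    (comm : ∀ {R : CommAlgCat.{u} k} (g : F.obj R),
      Y.act g ∘ₗ e.hom.hom.baseChange R = e.hom.hom.baseChange R ∘ₗ X.act g) : X ≅ Y where
  hom := { hom := e.hom, comm := comm }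
  inv :=
    { hom := e.inv
      comm := fun {R} g ↦ by
        have h1 : e.inv.hom.baseChange R ∘ₗ e.hom.hom.baseChange R = LinearMap.id := by
          rw [← LinearMap.baseChange_comp, ← ModuleCat.hom_comp, e.hom_inv_id]; simp
        have h2 : e.hom.hom.baseChange R ∘ₗ e.inv.hom.baseChange R = LinearMap.id := by
          rw [← LinearMap.baseChange_comp, ← ModuleCat.hom_comp, e.inv_hom_id]; simp
        calc X.act g ∘ₗ e.inv.hom.baseChange R
            = (e.inv.hom.baseChange R ∘ₗ e.hom.hom.baseChange R) ∘ₗ X.act g ∘ₗ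
                e.inv.hom.baseChange R := by rw [h1, LinearMap.id_comp]
          _ = e.inv.hom.baseChange R ∘ₗ (Y.act g ∘ₗ e.hom.hom.baseChange R) ∘ₗ
                e.inv.hom.baseChange R := by rw [comm]; simp only [LinearMap.comp_assoc]
          _ = e.inv.hom.baseChange R ∘ₗ Y.act g := by
                rw [LinearMap.comp_assoc, h2, LinearMap.comp_id] }
  hom_inv_id := hom_ext e.hom_inv_id
  inv_hom_id := hom_ext e.inv_hom_id

/-- The trivial representation on `k`. -/
def unit (F : CommAlgCat.{u} k ⥤ GrpCat.{u}) : LinRep F where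
  V := 𝟙_ (ModuleCat.{u} k)
  ρ :=
    { app := fun R ↦ GrpCat.ofHom 1
      naturality := fun R S f ↦ by
        ext g : 2
        exact (map_one ((generalLinear (𝟙_ (ModuleCat.{u} k))).map f).hom).symm }

/-- The tensor product of two representations: `g ∈ F(R)` acts on
`R ⊗ (V ⊗ W) ≃ (R ⊗ V) ⊗_R (R ⊗ W)` by `g ⊗ g`. -/
def tensor (X Y : LinRep F) : LinRep F where
  V := X.V ⊗ Y.V
  ρ :=
    { app := fun R ↦ GrpCat.ofHom
        ((Units.map (tensorEndHom R X.V Y.V)).comp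
          (MulEquiv.prodUnits.symm.toMonoidHom.comp
            (MonoidHom.prod (X.ρ.app R).hom (Y.ρ.app R).hom)))
      naturality := fun R S f ↦ by
        refine GrpCat.hom_ext (MonoidHom.ext fun g ↦ Units.ext ?_)
        change tensorEnd (X.act (F.map f g)) (Y.act (F.map f g)) =
          extEnd f.hom (tensorEnd (X.act g) (Y.act g))
        rw [act_map, act_map, extEnd_tensorEnd] }

lemma unit_act {R : CommAlgCat.{u} k} (g : F.obj R) : (unit F).act g = 1 := rfl

lemma tensor_act (X Y : LinRep F) {R : CommAlgCat.{u} k} (g : F.obj R) :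
    (tensor X Y).act g = tensorEnd (X.act g) (Y.act g) := rfl

/-- The tensor product of two morphisms of representations. -/
def tensorMap {X X' Y Y' : LinRep F} (f : X ⟶ X') (g : Y ⟶ Y') : tensor X Y ⟶ tensor X' Y' where
  hom := Hom.hom f ⊗ₘ Hom.hom g
  comm a := tensorEnd_comm_baseChange _ _ (f.comm a) (g.comm a)

instance : MonoidalCategoryStruct (LinRep F) where
  tensorObj := tensor
  tensorUnit := unit F
  tensorHom := tensorMap
  whiskerLeft X _ _ f := tensorMap (𝟙 X) f
  whiskerRight f X := tensorMap f (𝟙 X)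
  associator X Y Z := isoMk (α_ X.V Y.V Z.V) fun g ↦ tensorEnd_assoc (X.act g) (Y.act g) (Z.act g)
  leftUnitor X := isoMk (λ_ X.V) fun g ↦ tensorEnd_lid (X.act g)
  rightUnitor X := isoMk (ρ_ X.V) fun g ↦ tensorEnd_rid (X.act g)

/-- The forgetful functor preserves the tensor structure on the nose. -/
def inducingData : Monoidal.InducingFunctorData (forget F) where
  μIso _ _ := Iso.refl _
  εIso := Iso.refl _
  whiskerLeft_eq X _ _ f := by
    change (𝟙 X.V ⊗ₘ Hom.hom f) = 𝟙 _ ≫ (X.V ◁ Hom.hom f) ≫ 𝟙 _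
    simp
  whiskerRight_eq f X := by
    change (Hom.hom f ⊗ₘ 𝟙 X.V) = 𝟙 _ ≫ (Hom.hom f ▷ X.V) ≫ 𝟙 _
    simp
  tensorHom_eq f g := by
    change (Hom.hom f ⊗ₘ Hom.hom g) = 𝟙 _ ≫ (Hom.hom f ⊗ₘ Hom.hom g) ≫ 𝟙 _
    simp
  associator_eq X Y Z := by
    change (α_ X.V Y.V Z.V).hom =
      (𝟙 _ ≫ (𝟙 _ ⊗ₘ 𝟙 _)) ≫ (α_ X.V Y.V Z.V).hom ≫ (𝟙 _ ⊗ₘ 𝟙 _) ≫ 𝟙 _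
    simp
  leftUnitor_eq X := by
    change (λ_ X.V).hom = (𝟙 _ ≫ (𝟙 _ ⊗ₘ 𝟙 _)) ≫ (λ_ X.V).hom
    simp
  rightUnitor_eq X := by
    change (ρ_ X.V).hom = (𝟙 _ ≫ (𝟙 _ ⊗ₘ 𝟙 _)) ≫ (ρ_ X.V).hom
    simp

instance : MonoidalCategory (LinRep F) := Monoidal.induced (forget F) inducingData

instance : (forget F).Monoidal := Monoidal.fromInducedMonoidal (forget F) inducingData

instance : BraidedCategory (LinRep F) :=
  .ofFaithful (forget F)
    (fun X Y ↦ isoMk (β_ X.V Y.V) fun g ↦ tensorEnd_comm (X.act g) (Y.act g))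
    fun X Y ↦ by
      change 𝟙 _ ≫ (β_ X.V Y.V).hom = (β_ X.V Y.V).hom ≫ 𝟙 _
      simp

instance : SymmetricCategory (LinRep F) where
  symmetry X Y := hom_ext (SymmetricCategory.symmetry X.V Y.V)

/-- The property of being finite-dimensional. -/
def isFinite (F : CommAlgCat.{u} k ⥤ GrpCat.{u}) : ObjectProperty (LinRep F) :=
  fun X ↦ Module.Finite k X.V

instance : (isFinite F).IsMonoidal where
  prop_unit := Module.Finite.self k
  prop_tensor X Y hX hY :=
    have : Module.Finite k X.V := hX
    have : Module.Finite k Y.V := hY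
    Module.Finite.tensorProduct k X.V Y.V

end LinRep

/-- The category of finite-dimensional representations of a group functor; it is a symmetric
monoidal category as a full subcategory of `LinRep F`. -/
abbrev Repf (F : CommAlgCat.{u} k ⥤ GrpCat.{u}) : Type (u + 1) := (LinRep.isFinite F).FullSubcategory

end Representations

section Tannakian

/-- A tensorial category over a field `k`: a rigid abelian symmetric monoidal category with a
`k`-linear structure, such that `⊗` is `k`-bilinear and `k → End(𝟙)` is an isomorphism. -/
class TensorialCategory (k : Type u) [Field k] (C : Type v) [Category.{w} C] [Abelian C]
    [Linear k C] [MonoidalCategory C] [SymmetricCategory C] : Prop where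
  monoidalPreadditive : MonoidalPreadditive C
  monoidalLinear : MonoidalLinear k C
  exists_dual : ∀ X : C, ∃ Y : C, Nonempty (ExactPairing X Y)
  bijective_unit : Function.Bijective fun a : k ↦ (a • 𝟙 (𝟙_ C) : 𝟙_ C ⟶ 𝟙_ C)

/-- An `R`-valued fibre functor on `C`, for `R` a commutative `k`-algebra: an exact `k`-linear
tensor functor (that is, symmetric strong monoidal functor) from `C` to `Mod(R)`. -/
structure FibreFunctor (k : Type u) [Field k] (C : Type v) [Category.{w} C] [Abelian C]
    [Linear k C] [MonoidalCategory C] [SymmetricCategory C]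
    (R : Type u) [CommRing R] [Algebra k R] where
  /-- The underlying functor. -/
  functor : C ⥤ ModuleCat.{u} R
  /-- The tensor structure. -/
  braided : functor.Braided
  additive : functor.Additive
  map_smul : ∀ {X Y : C} (a : k) (f : X ⟶ Y),
    functor.map (a • f) = algebraMap k R a • functor.map f
  preservesFiniteLimits : Limits.PreservesFiniteLimits functor
  preservesFiniteColimits : Limits.PreservesFiniteColimits functor

/-- A tannakian category over `k`: a tensorial category over `k` that has an `R`-valued fibre
functor for some nonzero commutative `k`-algebra `R`. -/
class TannakianCategory (k : Type u) [Field k] (C : Type v) [Category.{w} C] [Abelian C]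
    [Linear k C] [MonoidalCategory C] [SymmetricCategory C] : Prop
    extends TensorialCategory k C where
  exists_fibreFunctor : ∃ (R : Type u) (_ : CommRing R) (_ : Algebra k R),
    Nontrivial R ∧ Nonempty (FibreFunctor k C R)

attribute [instance] FibreFunctor.braided

open Functor.LaxMonoidal Functor.OplaxMonoidal

variable {k : Type u} [Field k] {C : Type v} [Category.{w} C] [Abelian C]
    [Linear k C] [MonoidalCategory C] [SymmetricCategory C]

/-- The group `Aut^⊗(ω ⊗ R)`: families of `R`-linear automorphisms `a X` of `R ⊗ ω(X)`, natural
in `X` and compatible with the tensor structure of `ω`. -/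
def tensorAut (ω : FibreFunctor k C k) (R : Type u) [CommRing R] [Algebra k R] :
    Subgroup (∀ X : C, (Module.End R (R ⊗[k] ω.functor.obj X))ˣ) where
  carrier := { a |
    (∀ {X Y : C} (f : X ⟶ Y), (a Y).val ∘ₗ (ω.functor.map f).hom.baseChange R =
      (ω.functor.map f).hom.baseChange R ∘ₗ (a X).val) ∧
    (a (𝟙_ C)).val ∘ₗ (ε ω.functor).hom.baseChange R = (ε ω.functor).hom.baseChange R ∧
    ∀ X Y : C, (a (X ⊗ Y)).val ∘ₗ (μ ω.functor X Y).hom.baseChange R =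
      (μ ω.functor X Y).hom.baseChange R ∘ₗ tensorEnd (a X).val (a Y).val }
  one_mem' := by
    refine ⟨fun f ↦ rfl, rfl, fun X Y ↦ ?_⟩
    have h : tensorEnd (1 : Module.End R (R ⊗[k] ω.functor.obj X))
        (1 : Module.End R (R ⊗[k] ω.functor.obj Y)) = 1 := map_one (tensorEndHom R _ _)
    change _ = _ ∘ₗ tensorEnd 1 1
    rw [h]
    rfl
  mul_mem' := by
    rintro a b ⟨ha, ha', ha''⟩ ⟨hb, hb', hb''⟩
    refine ⟨fun f ↦ comm_mul (ha f) (hb f), comm_mul (b := 1) (b' := 1) ha' hb', fun X Y ↦ ?_⟩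
    exact (comm_mul (ha'' X Y) (hb'' X Y)).trans (congrArg _ (map_mul (tensorEndHom R _ _)
      ((a X).val, (a Y).val) ((b X).val, (b Y).val)).symm)
  inv_mem' := by
    rintro a ⟨ha, ha', ha''⟩
    refine ⟨fun f ↦ comm_inv (ha f), comm_inv (b := 1) ha', fun X Y ↦ ?_⟩
    exact comm_inv (b := Units.map (tensorEndHom R _ _) (MulEquiv.prodUnits.symm (a X, a Y)))
      (ha'' X Y)

lemma extEnd_mem_tensorAut (ω : FibreFunctor k C k) {R S : Type u} [CommRing R] [CommRing S]
    [Algebra k R] [Algebra k S] (f : R →ₐ[k] S)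
    {a : ∀ X : C, (Module.End R (R ⊗[k] ω.functor.obj X))ˣ} (ha : a ∈ tensorAut ω R) :
    (fun X ↦ Units.map (extEndHom f (ω.functor.obj X)) (a X)) ∈ tensorAut ω S := by
  obtain ⟨ha, ha', ha''⟩ := ha
  refine ⟨fun h ↦ extEnd_comm_baseChange f _ (ha h), ?_, fun X Y ↦ ?_⟩
  · refine (extEnd_comm_baseChange f (a := 1) _ ha').trans ?_
    have h : extEnd f (1 : Module.End R (R ⊗[k] 𝟙_ (ModuleCat.{u} k))) = 1 :=
      map_one (extEndHom f _)
    rw [h]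
    rfl
  · exact (extEnd_comm_baseChange f _ (ha'' X Y)).trans
      (congrArg _ (extEnd_tensorEnd f (a X).val (a Y).val))

/-- The functor `R ↦ Aut^⊗(ω ⊗ R)` on commutative `k`-algebras; a homomorphism `R → S` acts by
base change of automorphisms. -/
def tensorAutFunctor (ω : FibreFunctor k C k) : CommAlgCat.{u} k ⥤ GrpCat.{max v u} where
  obj R := GrpCat.of (tensorAut ω R)
  map f := GrpCat.ofHom
    { toFun a := ⟨_, extEnd_mem_tensorAut ω f.hom a.2⟩
      map_one' := Subtype.ext (funext fun _ ↦ map_one (Units.map (extEndHom f.hom _)))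
      map_mul' a b := Subtype.ext (funext fun X ↦
        map_mul (Units.map (extEndHom f.hom _)) (a.1 X) (b.1 X)) }
  map_id _ := GrpCat.hom_ext <| MonoidHom.ext fun a ↦ Subtype.ext <| funext fun X ↦
    Units.ext (extEnd_id (a.1 X).val)
  map_comp f g := GrpCat.hom_ext <| MonoidHom.ext fun a ↦ Subtype.ext <| funext fun X ↦
    Units.ext (extEnd_comp f.hom g.hom (a.1 X).val)

end Tannakian

section GroupSchemes

open AlgebraicGeometry

/-- An affine group scheme over `k`: a group object in the category of schemes over `Spec k`,
whose underlying scheme is affine. -/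
structure AffineGroupScheme (k : Type u) [Field k] where
  /-- The group scheme. -/
  toGrp : Grp (Over (Spec (CommRingCat.of k)))
  isAffine : IsAffine toGrp.X.left

/-- The functor of points `R ↦ G(R)` of a group scheme over `k`, with values in groups,
restricted to commutative `k`-algebras. -/
def AffineGroupScheme.points {k : Type u} [Field k] (G : AffineGroupScheme k) :
    CommAlgCat.{u} k ⥤ GrpCat.{u} :=
  (algSpec (CommRingCat.of k)).rightOp ⋙ yonedaGrpObj G.toGrp.X

end GroupSchemes

section Reconstruction

variable {k : Type u} [Field k] {C : Type v} [Category.{w} C] [Abelian C]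
    [Linear k C] [MonoidalCategory C] [SymmetricCategory C]

open Functor.LaxMonoidal Functor.OplaxMonoidal Functor.Monoidal

/-- A module with a dual is finite. -/
lemma finite_of_dual {V W : ModuleCat.{u} k} (c : 𝟙_ (ModuleCat.{u} k) ⟶ V ⊗ W)
    (e : W ⊗ V ⟶ 𝟙_ (ModuleCat.{u} k))
    (h : c ▷ V ≫ (α_ V W V).hom ≫ V ◁ e = (λ_ V).hom ≫ (ρ_ V).inv) : Module.Finite k V := by
  classical
  obtain ⟨S, hS⟩ := TensorProduct.exists_finset (R := k) (M := V) (N := W) (c.hom (1 : k))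
  refine ⟨S.image Prod.fst, eq_top_iff.2 fun v _ ↦ ?_⟩
  have hv := congrArg (TensorProduct.rid k V) (LinearMap.congr_fun (congrArg ModuleCat.Hom.hom h)
    ((1 : k) ⊗ₜ[k] v))
  have hr : TensorProduct.rid k V (((λ_ V).hom ≫ (ρ_ V).inv).hom ((1 : k) ⊗ₜ[k] v)) = v := by
    change TensorProduct.rid k V ((TensorProduct.rid k V).symm
      (TensorProduct.lid k V ((1 : k) ⊗ₜ[k] v))) = v
    simp
  have hl : TensorProduct.rid k V ((c ▷ V ≫ (α_ V W V).hom ≫ V ◁ e).hom ((1 : k) ⊗ₜ[k] v)) =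
      TensorProduct.rid k V (LinearMap.lTensor V e.hom
        (TensorProduct.assoc k V W V (c.hom (1 : k) ⊗ₜ[k] v))) := rfl
  rw [hr, hl, hS, TensorProduct.sum_tmul, map_sum, map_sum, map_sum] at hv
  rw [← hv]
  refine Submodule.sum_mem _ fun i hi ↦ ?_
  rw [TensorProduct.assoc_tmul, LinearMap.lTensor_tmul, TensorProduct.rid_tmul]
  exact Submodule.smul_mem _ _ (Submodule.subset_span (by
    simpa using ⟨_, hi⟩))

lemma finite_obj [TensorialCategory k C] (ω : FibreFunctor k C k) (X : C) :
    Module.Finite k (ω.functor.obj X) := by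
  obtain ⟨Y, ⟨_⟩⟩ := TensorialCategory.exists_dual (k := k) X
  let F := ω.functor
  refine finite_of_dual (V := F.obj X) (W := F.obj Y)
    (ε F ≫ F.map (ExactPairing.coevaluation X Y) ≫ δ F X Y)
    (μ F Y X ≫ F.map (ExactPairing.evaluation X Y) ≫ η F) ?_
  have h := congrArg (fun f ↦ ε F ▷ F.obj X ≫ μ F _ _ ≫ F.map f ≫ δ F _ _ ≫ F.obj X ◁ η F)
    (ExactPairing.evaluation_coevaluation X Y)
  simp only [Functor.Monoidal.map_whiskerRight, Functor.Monoidal.map_whiskerLeft,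
    Functor.map_comp, Functor.Monoidal.map_associator, Category.assoc,
    Functor.Monoidal.μ_δ_assoc, Functor.Monoidal.map_leftUnitor,
    Functor.Monoidal.map_rightUnitor_inv, comp_whiskerRight,
    MonoidalCategory.whiskerLeft_comp] at h ⊢
  rw [h]
  simp

variable [TensorialCategory k C] {F : CommAlgCat.{u} k ⥤ GrpCat.{u}}

/-- The representation of `F` on `ω(X)` attached to a homomorphism `F → Aut^⊗(ω ⊗ -)`. -/
def repObj (ω : FibreFunctor k C k) (φ : F ⋙ GrpCat.uliftFunctor.{v} ⟶ tensorAutFunctor ω)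
    (X : C) : LinRep F where
  V := ω.functor.obj X
  ρ :=
    { app R := GrpCat.ofHom
        { toFun g := ((φ.app R).hom (ULift.up g)).1 X
          map_one' := congrArg (fun a ↦ a.1 X) (map_one (φ.app R).hom)
          map_mul' g h := congrArg (fun a ↦ a.1 X)
            (map_mul (φ.app R).hom (ULift.up g) (ULift.up h)) }
      naturality _ _ f := GrpCat.hom_ext <| MonoidHom.ext fun g ↦
        congrArg (fun a ↦ a.1 X) (ConcreteCategory.congr_hom (φ.naturality f) (ULift.up g)) }

/-- The morphism of representations given by `ω(f)`. -/
def repMap (ω : FibreFunctor k C k) (φ : F ⋙ GrpCat.uliftFunctor.{v} ⟶ tensorAutFunctor ω)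
    {X Y : C} (f : X ⟶ Y) : repObj ω φ X ⟶ repObj ω φ Y where
  hom := ω.functor.map f
  comm {R} g := ((φ.app R).hom (ULift.up g)).2.1 f

/-- The functor `C → Repf(F)` defined by a fibre functor `ω` and a homomorphism
`F → Aut^⊗(ω ⊗ -)`: it sends `X` to `ω(X)` with the induced action of `F`. -/
def repFunctor (ω : FibreFunctor k C k)
    (φ : F ⋙ GrpCat.uliftFunctor.{v} ⟶ tensorAutFunctor ω) : C ⥤ Repf F where
  obj X := ⟨repObj ω φ X, finite_obj ω X⟩
  map f := ObjectProperty.homMk (repMap ω φ f)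
  map_id X := ObjectProperty.hom_ext _ (LinRep.hom_ext (ω.functor.map_id X))
  map_comp f g := ObjectProperty.hom_ext _ (LinRep.hom_ext (ω.functor.map_comp f g))

/-- The tensor structure of `ω` consists of morphisms of representations. -/
def repFunctorCore (ω : FibreFunctor k C k)
    (φ : F ⋙ GrpCat.uliftFunctor.{v} ⟶ tensorAutFunctor ω) : (repFunctor ω φ).CoreMonoidal where
  εIso := ObjectProperty.isoMk _ (LinRep.isoMk (X := LinRep.unit F) (Y := repObj ω φ (𝟙_ C))
    (εIso ω.functor) fun {R} g ↦ ((φ.app R).hom (ULift.up g)).2.2.1)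
  μIso X Y := ObjectProperty.isoMk _
    (LinRep.isoMk (X := LinRep.tensor (repObj ω φ X) (repObj ω φ Y)) (Y := repObj ω φ (X ⊗ Y))
      (μIso ω.functor X Y) fun {R} g ↦ ((φ.app R).hom (ULift.up g)).2.2.2 X Y)
  μIso_hom_natural_left f X := ObjectProperty.hom_ext _ <| LinRep.hom_ext <| by
    change (ω.functor.map f ⊗ₘ 𝟙 (ω.functor.obj X)) ≫ μ ω.functor _ _ =
      μ ω.functor _ _ ≫ ω.functor.map (f ▷ X)
    simp
  μIso_hom_natural_right X f := ObjectProperty.hom_ext _ <| LinRep.hom_ext <| by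
    change (𝟙 (ω.functor.obj X) ⊗ₘ ω.functor.map f) ≫ μ ω.functor _ _ =
      μ ω.functor _ _ ≫ ω.functor.map (X ◁ f)
    simp
  associativity X Y Z := ObjectProperty.hom_ext _ <| LinRep.hom_ext <| by
    change (μ ω.functor X Y ⊗ₘ 𝟙 (ω.functor.obj Z)) ≫ μ ω.functor _ _ ≫
        ω.functor.map (α_ X Y Z).hom =
      (α_ _ _ _).hom ≫ (𝟙 (ω.functor.obj X) ⊗ₘ μ ω.functor Y Z) ≫ μ ω.functor _ _
    simp
  left_unitality X := ObjectProperty.hom_ext _ <| LinRep.hom_ext <| by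
    change (λ_ (ω.functor.obj X)).hom = (ε ω.functor ⊗ₘ 𝟙 (ω.functor.obj X)) ≫
      μ ω.functor _ _ ≫ ω.functor.map (λ_ X).hom
    simp
  right_unitality X := ObjectProperty.hom_ext _ <| LinRep.hom_ext <| by
    change (ρ_ (ω.functor.obj X)).hom = (𝟙 (ω.functor.obj X) ⊗ₘ ε ω.functor) ≫
      μ ω.functor _ _ ≫ ω.functor.map (ρ_ X).hom
    simp

/-- The functor `C → Repf(F)` is a tensor functor. -/
instance repFunctorBraided (ω : FibreFunctor k C k)
    (φ : F ⋙ GrpCat.uliftFunctor.{v} ⟶ tensorAutFunctor ω) : (repFunctor ω φ).Braided where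
  toMonoidal := (repFunctorCore ω φ).toMonoidal
  braided X Y := ObjectProperty.hom_ext _ <| LinRep.hom_ext <| by
    change μ ω.functor X Y ≫ ω.functor.map (β_ X Y).hom =
      (β_ (ω.functor.obj X) (ω.functor.obj Y)).hom ≫ μ ω.functor Y X
    simp

/-- A tensor functor is an equivalence of tensor categories if the underlying functor is an
equivalence of categories. -/
def IsTensorEquivalence {D : Type v} [Category.{w} D] [MonoidalCategory D] [SymmetricCategory D]
    {E : Type (u + 1)} [Category.{u} E] [MonoidalCategory E] [SymmetricCategory E]
    (Φ : D ⥤ E) [Φ.Braided] : Prop :=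
  Φ.IsEquivalence

end Reconstruction
end

end NeutralTannaka

open NeutralTannaka

/-! The coordinate ring of the group is the algebra `CoefRing ω` of matrix coefficients of `ω`. Its
elements are classes of triples `(X, x, ξ)`, with `x` in `ω(X)` and `ξ` a linear form on `ω(X)`, a
morphism being allowed to slide from the vector to the form. Since `ω` preserves pullbacks, two
triples have the same class exactly when some object maps to both and carries a common lift of the
vectors on which the forms agree. Sums come from direct sums and products from tensor products.

(a) An automorphism of `ω ⊗ R` is a family of matrices over `R`. Naturality says that an entry
depends only on its class, and compatibility with `⊗` says that the entries define an algebra map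
`CoefRing ω → R`. Conversely such a map defines endomorphisms of all `R ⊗ ω(X)`, and these are
invertible because `X` has a dual (`isUnit_endOfAlgHom`). So `CoefRing ω`, which is small because
`C` is essentially small, represents the automorphism functor.

(b) A quotient of `𝟙` is a direct summand, hence is `0` or `𝟙` because `End(𝟙) = k`. Applied to the
image of a coevaluation, this shows that `ω` kills no nonzero object, so it is faithful and reflects
isomorphisms. The central point is `exists_mono_range_eq`: a subspace `W` of `ω(X)` is the image of
a subobject as soon as the coefficients of its vectors at the forms vanishing on `W` are zero, that
is, as soon as `W` is stable under the group. It rests on the explicit meaning of a vanishing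
coefficient (`CoefRing.mk_eq_zero_iff`). Graphs of equivariant maps are stable, which gives
fullness; kernels are stable, so the essential image is closed under quotients.

It remains to cover any finite-dimensional representation `V` by some `ω(M)` (`exists_surjective`).
At the universal automorphism, `V` is a matrix of coefficients, all of which live on one object `Y`.
They define a linear map `ω(Y) → V`. The subspace where this map commutes with the universal
automorphism is stable, and it already maps onto `V`. -/

namespace NeutralTannaka

noncomputable section

/-! ### Quotients of the unit object -/

section UnitObject

open Limits

variable {C : Type v} [Category.{w} C] [MonoidalCategory C]

/-- If tensoring with a dualizable object `J` kills the kernel of `p`, then `p ▷ J` is a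
monomorphism. -/
lemma mono_whiskerRight_of_kernel [Abelian C] [MonoidalPreadditive C] {X Y J : C}
    (p : X ⟶ Y) {I : C} [ExactPairing I J]
    (h : kernel.ι p ▷ J = 0) : Mono (p ▷ J) := by
  have hadj := tensorRightAdjunction I J
  have : (tensorRight J).IsRightAdjoint := ⟨_, ⟨hadj⟩⟩
  have hS : (ShortComplex.mk _ _ (kernel.condition p)).Exact :=
    ShortComplex.exact_of_f_is_kernel _ (kernelIsKernel p)
  have hS' := hS.map_of_mono_of_preservesKernel (tensorRight J)
    (by dsimp; infer_instance) inferInstance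
  exact hS'.mono_g h

lemma epi_whiskerRight {X Y : C} (p : X ⟶ Y) [Epi p] {I J : C} [ExactPairing I J] :
    Epi (p ▷ I) := by
  have : (tensorRight I).IsLeftAdjoint := ⟨_, ⟨tensorRightAdjunction I J⟩⟩
  exact inferInstanceAs (Epi ((tensorRight I).map p))

lemma epi_whiskerLeft {X Y : C} (p : X ⟶ Y) [Epi p] {I J : C} [ExactPairing I J] :
    Epi (J ◁ p) := by
  have : (tensorLeft J).IsLeftAdjoint := ⟨_, ⟨tensorLeftAdjunction I J⟩⟩
  exact inferInstanceAs (Epi ((tensorLeft J).map p))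

variable [Abelian C]

/-- By the exchange law, the composite of the epimorphism `K ◁ p` with `i ▷ I` is `i ≫ p` up to
unitors. -/
lemma kernel_whiskerRight_self {I : C} (p : 𝟙_ C ⟶ I) {K : C} (i : K ⟶ 𝟙_ C) (hi : i ≫ p = 0)
    [Epi (K ◁ p)] : i ▷ I = 0 := by
  rw [← cancel_epi (K ◁ p), whisker_exchange, comp_zero]
  have h1 : i ▷ 𝟙_ C = (ρ_ K).hom ≫ i ≫ (ρ_ _).inv := by simp
  have h2 : 𝟙_ C ◁ p = (λ_ (𝟙_ C)).hom ≫ p ≫ (λ_ _).inv := by simp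
  rw [h1, h2, unitors_equal]
  simp [reassoc_of% hi]

variable [SymmetricCategory C] [MonoidalPreadditive C]

/-- By the zigzag identity `i ▷ J` factors through `i ▷ (J ⊗ I ⊗ J)`, which vanishes because the
factor `I` can be braided to the front. -/
lemma whiskerRight_dual_eq_zero {I J K L : C} [ExactPairing I J] (i : K ⟶ L) (hi : i ▷ I = 0) :
    i ▷ J = 0 := by
  have hJ : ∀ Z : C, i ▷ (I ⊗ Z) = 0 := fun Z ↦ by
    simp [hi]
  have hIJ : i ▷ (J ⊗ (I ⊗ J)) = 0 := by
    have e : J ⊗ (I ⊗ J) ≅ I ⊗ (J ⊗ J) := (α_ _ _ _).symm ≪≫ whiskerRightIso (β_ J I) J ≪≫ α_ _ _ _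
    rw [← cancel_mono (L ◁ e.hom), ← whisker_exchange, hJ, zero_comp, comp_zero]
  have hr : (ρ_ J).inv ≫ J ◁ η_ I J ≫ (α_ J I J).inv ≫ ε_ I J ▷ J ≫ (λ_ J).hom = 𝟙 J := by
    rw [ExactPairing.coevaluation_evaluation_assoc]; simp
  have hm : i ▷ J ≫ L ◁ ((ρ_ J).inv ≫ J ◁ η_ I J) = 0 := by
    rw [← whisker_exchange, hIJ, comp_zero]
  have : i ▷ J = (i ▷ J ≫ L ◁ ((ρ_ J).inv ≫ J ◁ η_ I J)) ≫
      L ◁ ((α_ J I J).inv ≫ ε_ I J ▷ J ≫ (λ_ J).hom) := by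
    rw [Category.assoc, ← MonoidalCategory.whiskerLeft_comp, Category.assoc, hr]; simp
  rw [this, hm, zero_comp]

/-- A quotient of the unit object of a rigid abelian tensor category is a direct summand. -/
lemma exists_section_of_epi_unit {I J : C} [ExactPairing I J]
    (hrig : ∀ X : C, ∃ Y : C, Nonempty (ExactPairing X Y)) (p : 𝟙_ C ⟶ I) [Epi p] :
    ∃ s : I ⟶ 𝟙_ C, s ≫ p = 𝟙 I := by
  have h0 : kernel.ι p ▷ I = 0 := by
    obtain ⟨L, ⟨_⟩⟩ := hrig (kernel p)
    let := BraidedCategory.exactPairing_swap (kernel p) L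
    have := epi_whiskerLeft p (I := L) (J := kernel p)
    exact kernel_whiskerRight_self p _ (kernel.condition p)
  have hJ := whiskerRight_dual_eq_zero (J := J) _ h0
  have := mono_whiskerRight_of_kernel (I := I) p hJ
  let := BraidedCategory.exactPairing_swap I J
  have := epi_whiskerRight p (I := J) (J := I)
  have : IsIso (p ▷ J) := isIso_of_mono_of_epi _
  -- `t` is the transpose of the identity of `I`. It lifts through the isomorphism `p ▷ J`, and
  -- transposing the lift back gives the section.
  let t := tensorRightHomEquiv (𝟙_ C) I J I (λ_ I).hom
  refine ⟨(λ_ I).inv ≫ (tensorRightHomEquiv (𝟙_ C) I J (𝟙_ C)).symm (t ≫ inv (p ▷ J)), ?_⟩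
  rw [Category.assoc, Iso.inv_comp_eq, Category.comp_id]
  apply (tensorRightHomEquiv (𝟙_ C) I J I).injective
  rw [tensorRightHomEquiv_naturality, Equiv.apply_symm_apply, Category.assoc]
  simp [t]

end UnitObject

/-! ### Faithfulness of fibre functors -/

section Faithful

open Limits

variable {C : Type v} [Category.{w} C] [Abelian C] [MonoidalCategory C] [SymmetricCategory C]

/-- For a section `s`, the composite `p ≫ s` is an idempotent of `End(𝟙) = k`, hence `0` or `1`. -/
lemma isIso_or_isZero_of_epi_unit (k : Type u) [Field k] [Linear k C] [TensorialCategory k C]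
    {I : C} (p : 𝟙_ C ⟶ I) [Epi p] : IsIso p ∨ IsZero I := by
  have := TensorialCategory.monoidalPreadditive (k := k) (C := C)
  obtain ⟨J, ⟨_⟩⟩ := TensorialCategory.exists_dual (k := k) I
  obtain ⟨s, hs⟩ := exists_section_of_epi_unit (TensorialCategory.exists_dual (k := k)) p (J := J)
  obtain ⟨hinj, hsurj⟩ := TensorialCategory.bijective_unit (k := k) (C := C)
  obtain ⟨c, hc⟩ := hsurj (p ≫ s)
  have hcc : c * c = c := hinj <| by
    have : (p ≫ s) ≫ p ≫ s = p ≫ s := by simp [reassoc_of% hs]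
    dsimp only at hc ⊢
    rw [← hc] at this
    simpa [smul_smul] using this
  rcases IsIdempotentElem.iff_eq_zero_or_one.1 hcc with rfl | rfl
  · right
    have hps : p ≫ s = 0 := by simpa using hc.symm
    have hs0 : s = 0 := (cancel_epi p).1 (by rw [hps, comp_zero])
    rw [IsZero.iff_id_eq_zero, ← hs, hs0, zero_comp]
  · left
    exact ⟨s, by simpa using hc.symm, hs⟩

variable {k : Type u} [Field k] [Linear k C] [TensorialCategory k C]

/-- The image of the coevaluation `𝟙 ⟶ X ⊗ Y` is a quotient of `𝟙` killed by `ω`, whereas `ω(𝟙) ≅ k`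
is nonzero. So the coevaluation vanishes, and the zigzag identity gives `𝟙 X = 0`. -/
lemma isZero_of_isZero_map (ω : FibreFunctor k C k) {X : C} (h : IsZero (ω.functor.obj X)) :
    IsZero X := by
  have := TensorialCategory.monoidalPreadditive (k := k) (C := C)
  have := ω.preservesFiniteLimits
  have := ω.preservesFiniteColimits
  have := ω.additive
  obtain ⟨Y, ⟨_⟩⟩ := TensorialCategory.exists_dual (k := k) X
  let c : 𝟙_ C ⟶ X ⊗ Y := η_ X Y
  have hXY : IsZero (ω.functor.obj (X ⊗ Y)) := by
    refine IsZero.of_iso ?_ (Functor.Monoidal.μIso ω.functor X Y).symm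
    rw [IsZero.iff_id_eq_zero] at h ⊢
    rw [← id_whiskerRight, h]
    simp
  have hI : IsZero (ω.functor.obj (image c)) := IsZero.of_mono (ω.functor.map (image.ι c)) hXY
  have hIz : IsZero (image c) := by
    refine (isIso_or_isZero_of_epi_unit k (factorThruImage c)).resolve_left fun _ ↦ ?_
    have h1 : IsZero (𝟙_ (ModuleCat.{u} k)) :=
      hI.of_iso (Functor.Monoidal.εIso ω.functor ≪≫ ω.functor.mapIso (asIso (factorThruImage c)))
    rw [ModuleCat.isZero_iff_subsingleton] at h1
    exact not_subsingleton k h1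
  have hc : c = 0 := by
    rw [← image.fac c, hIz.eq_zero_of_src (image.ι c), comp_zero]
  rw [IsZero.iff_id_eq_zero]
  have hX : (λ_ X).inv ≫ η_ X Y ▷ X ≫ (α_ X Y X).hom ≫ X ◁ ε_ X Y ≫ (ρ_ X).hom = 𝟙 X := by
    rw [ExactPairing.evaluation_coevaluation_assoc]; simp
  rw [← hX, show η_ X Y = 0 from hc]
  simp

/-- If `ω` kills `f - g`, it kills the image of `f - g`, which is then zero. -/
lemma FibreFunctor.faithful (ω : FibreFunctor k C k) : ω.functor.Faithful := by
  have := ω.preservesFiniteLimits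
  have := ω.preservesFiniteColimits
  have := ω.additive
  refine ⟨fun {X Y f g} h ↦ ?_⟩
  rw [← sub_eq_zero]
  have h0 : ω.functor.map (factorThruImage (f - g)) ≫ ω.functor.map (image.ι (f - g)) = 0 := by
    rw [← Functor.map_comp, image.fac, Functor.map_sub, h, sub_self]
  have h1 : ω.functor.map (image.ι (f - g)) = 0 :=
    (cancel_epi (ω.functor.map (factorThruImage (f - g)))).1 (by rw [h0, comp_zero])
  have hI : IsZero (image (f - g)) :=
    isZero_of_isZero_map ω (IsZero.of_mono_eq_zero (ω.functor.map (image.ι (f - g))) h1)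
  rw [← image.fac (f - g), hI.eq_zero_of_src (image.ι _), comp_zero]

end Faithful

/-! ### Matrix coefficients of endomorphisms of `R ⊗ V` -/

section MatrixCoefficients

variable {k : Type u} [CommRing k] {R S : Type u} [CommRing R] [CommRing S]
  [Algebra k R] [Algebra k S] {V W U : Type u} [AddCommGroup V] [Module k V] [AddCommGroup W]
  [Module k W] [AddCommGroup U] [Module k U]

/-- The `R`-linear form on `R ⊗ V` attached to a linear form on `V`. -/
def pair (R : Type u) [CommRing R] [Algebra k R] (ξ : Module.Dual k V) : R ⊗[k] V →ₗ[R] R :=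
  LinearMap.liftBaseChange R (Algebra.linearMap k R ∘ₗ ξ)

@[simp]
lemma pair_tmul (ξ : Module.Dual k V) (r : R) (x : V) : pair R ξ (r ⊗ₜ[k] x) = ξ x • r := by
  simp [pair, Algebra.smul_def, mul_comm]

lemma pair_add (ξ η : Module.Dual k V) (z : R ⊗[k] V) :
    pair R (ξ + η) z = pair R ξ z + pair R η z := by
  induction z with
  | zero => simp
  | tmul r x => simp [add_smul]
  | add x y hx hy => simp only [map_add, hx, hy]; ring

lemma pair_smul (c : k) (ξ : Module.Dual k V) (z : R ⊗[k] V) :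
    pair R (c • ξ) z = c • pair R ξ z := by
  induction z with
  | zero => simp
  | tmul r x => simp [mul_smul]
  | add x y hx hy => simp only [map_add, hx, hy, smul_add]

lemma pair_baseChange (h : V →ₗ[k] W) (η : Module.Dual k W) (z : R ⊗[k] V) :
    pair R η (h.baseChange R z) = pair R (η ∘ₗ h) z := by
  induction z with
  | zero => simp
  | tmul r x => simp
  | add x y hx hy => simp only [map_add, hx, hy]

lemma pair_scalarMap (f : R →ₐ[k] S) (ξ : Module.Dual k V) (z : R ⊗[k] V) :
    pair S ξ (scalarMap f V z) = f (pair R ξ z) := by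
  induction z with
  | zero => simp
  | tmul r x => simp
  | add x y hx hy => simp only [map_add, hx, hy]

lemma pair_tmulR (ξ : Module.Dual k V) (η : Module.Dual k W) (p : R ⊗[k] V) (q : R ⊗[k] W) :
    pair R (dualDistrib k V W (ξ ⊗ₜ η)) (tmulR p q) = pair R ξ p * pair R η q := by
  induction p with
  | zero => simp
  | add x x' hx hx' => simp only [add_tmulR, map_add, hx, hx', add_mul]
  | tmul r x =>
    induction q with
    | zero => simp
    | add y y' hy hy' => simp only [tmulR_add, map_add, hy, hy', mul_add]
    | tmul s y => simp [mul_smul, smul_comm (ξ x)]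

lemma sum_pair_tmul {ι : Type*} [Fintype ι] (b : Module.Basis ι k V) (z : R ⊗[k] V) :
    ∑ i, pair R (b.coord i) z ⊗ₜ[k] b i = z := by
  induction z with
  | zero => simp
  | add x y hx hy => simp only [map_add, TensorProduct.add_tmul, Finset.sum_add_distrib, hx, hy]
  | tmul r x =>
    conv_rhs => rw [← b.sum_repr x, TensorProduct.tmul_sum]
    exact Finset.sum_congr rfl fun i _ ↦ by simp [TensorProduct.smul_tmul]

lemma pair_ext_basis {ι : Type*} [Fintype ι] (b : Module.Basis ι k V) {z z' : R ⊗[k] V}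
    (h : ∀ i, pair R (b.coord i) z = pair R (b.coord i) z') : z = z' := by
  rw [← sum_pair_tmul b z, ← sum_pair_tmul b z']
  simp only [h]

/-- The matrix coefficient of an endomorphism `a` of `R ⊗ V` at a vector and a linear form. -/
def coef (a : Module.End R (R ⊗[k] V)) (x : V) (ξ : Module.Dual k V) : R :=
  pair R ξ (a (1 ⊗ₜ[k] x))

lemma coef_add_left (a : Module.End R (R ⊗[k] V)) (x y : V) (ξ : Module.Dual k V) :
    coef a (x + y) ξ = coef a x ξ + coef a y ξ := by
  simp [coef, TensorProduct.tmul_add]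

lemma coef_smul_left (a : Module.End R (R ⊗[k] V)) (c : k) (x : V) (ξ : Module.Dual k V) :
    coef a (c • x) ξ = c • coef a x ξ := by
  rw [coef, coef, Algebra.smul_def, ← smul_eq_mul, ← map_smul, ← map_smul,
    algebraMap_smul, TensorProduct.tmul_smul]

lemma coef_add_right (a : Module.End R (R ⊗[k] V)) (x : V) (ξ η : Module.Dual k V) :
    coef a x (ξ + η) = coef a x ξ + coef a x η := pair_add _ _ _

lemma coef_smul_right (a : Module.End R (R ⊗[k] V)) (c : k) (x : V) (ξ : Module.Dual k V) :
    coef a x (c • ξ) = c • coef a x ξ := pair_smul _ _ _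

/-- Matrix coefficients as a bilinear map. -/
def coefBilin (a : Module.End R (R ⊗[k] V)) : V →ₗ[k] Module.Dual k V →ₗ[k] R :=
  LinearMap.mk₂ k (coef a) (coef_add_left a) (coef_smul_left a) (coef_add_right a)
    (coef_smul_right a)

@[simp] lemma coefBilin_apply (a : Module.End R (R ⊗[k] V)) (x : V) (ξ : Module.Dual k V) :
    coefBilin a x ξ = coef a x ξ := rfl

lemma pair_apply (a : Module.End R (R ⊗[k] V)) {ι : Type*} [Fintype ι] (b : Module.Basis ι k V)
    (ξ : Module.Dual k V) (z : R ⊗[k] V) :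
    pair R ξ (a z) = ∑ i, pair R (b.coord i) z * coef a (b i) ξ := by
  conv_lhs => rw [← sum_pair_tmul b z, map_sum, map_sum]
  refine Finset.sum_congr rfl fun i _ ↦ ?_
  have : pair R (b.coord i) z ⊗ₜ[k] b i = pair R (b.coord i) z • ((1 : R) ⊗ₜ[k] b i) := by
    simp [TensorProduct.smul_tmul']
  rw [this, map_smul, map_smul, smul_eq_mul, coef]

/-- In `a * a'` the factor `a'` acts first, so its coefficients are the ones taken at `x`. This
fixes the order of the factors in `exists_comul`. -/
lemma coef_mul (a a' : Module.End R (R ⊗[k] V)) {ι : Type*} [Fintype ι] (b : Module.Basis ι k V)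
    (x : V) (ξ : Module.Dual k V) :
    coef (a * a') x ξ = ∑ i, coef a' x (b.coord i) * coef a (b i) ξ :=
  pair_apply a b ξ _

lemma coef_one (x : V) (ξ : Module.Dual k V) :
    coef (1 : Module.End R (R ⊗[k] V)) x ξ = algebraMap k R (ξ x) := by
  simp [coef, Algebra.smul_def]

lemma coef_extEnd (f : R →ₐ[k] S) (a : Module.End R (R ⊗[k] V)) (x : V) (ξ : Module.Dual k V) :
    coef (extEnd f a) x ξ = f (coef a x ξ) := by
  have : (1 : S) ⊗ₜ[k] x = scalarMap f V (1 ⊗ₜ[k] x) := by simp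
  rw [coef, this, extEnd_scalarMap, pair_scalarMap, coef]

lemma coef_tensorEnd (a : Module.End R (R ⊗[k] V)) (b : Module.End R (R ⊗[k] W))
    (x : V) (y : W) (ξ : Module.Dual k V) (η : Module.Dual k W) :
    coef (tensorEnd a b) (x ⊗ₜ[k] y) (dualDistrib k V W (ξ ⊗ₜ η)) = coef a x ξ * coef b y η := by
  have : (1 : R) ⊗ₜ[k] (x ⊗ₜ[k] y) = tmulR ((1 : R) ⊗ₜ[k] x) ((1 : R) ⊗ₜ[k] y) := by simp
  rw [coef, this, tensorEnd_tmulR, pair_tmulR, coef, coef]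

lemma coef_comm {h : V →ₗ[k] W} {a : Module.End R (R ⊗[k] V)} {b : Module.End R (R ⊗[k] W)}
    (hab : b ∘ₗ h.baseChange R = h.baseChange R ∘ₗ a) (x : V) (η : Module.Dual k W) :
    coef b (h x) η = coef a x (η ∘ₗ h) := by
  have := congrArg (pair R η) (LinearMap.congr_fun hab (1 ⊗ₜ[k] x))
  simpa [pair_baseChange, coef] using this

variable [Module.Free k W] [Module.Finite k W]

lemma pair_ext {z z' : R ⊗[k] W} (h : ∀ ξ, pair R ξ z = pair R ξ z') : z = z' :=
  pair_ext_basis (Module.Free.chooseBasis k W) fun _ ↦ h _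

/-- Converse of `coef_comm`: through it, commutation with an action becomes an identity between
coefficients. -/
lemma comm_of_coef {h : V →ₗ[k] W} {a : Module.End R (R ⊗[k] V)} {b : Module.End R (R ⊗[k] W)}
    (hab : ∀ x η, coef b (h x) η = coef a x (η ∘ₗ h)) :
    b ∘ₗ h.baseChange R = h.baseChange R ∘ₗ a := by
  ext x
  refine pair_ext fun η ↦ ?_
  simpa [pair_baseChange, coef] using hab x η

variable [Module.Free k V] [Module.Finite k V]

lemma pair_ext_tensor {z z' : R ⊗[k] (V ⊗[k] W)}
    (h : ∀ ξ η, pair R (dualDistrib k V W (ξ ⊗ₜ η)) z = pair R (dualDistrib k V W (ξ ⊗ₜ η)) z') :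
    z = z' := by
  refine pair_ext_basis ((Module.Free.chooseBasis k V).tensorProduct
    (Module.Free.chooseBasis k W)) fun ⟨i, j⟩ ↦ ?_
  convert h ((Module.Free.chooseBasis k V).coord i) ((Module.Free.chooseBasis k W).coord j)
    using 2 <;>
  · congr 1
    ext x y
    simp [Module.Basis.tensorProduct_repr_tmul_apply, mul_comm]

lemma tensor_comm_of_coef {m : V ⊗[k] W ≃ₗ[k] U} {a : Module.End R (R ⊗[k] V)}
    {b : Module.End R (R ⊗[k] W)} {c : Module.End R (R ⊗[k] U)}
    (h : ∀ x y ξ η, coef c (m (x ⊗ₜ y)) (dualDistrib k V W (ξ ⊗ₜ η) ∘ₗ m.symm.toLinearMap) =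
      coef a x ξ * coef b y η) :
    c ∘ₗ m.toLinearMap.baseChange R = m.toLinearMap.baseChange R ∘ₗ tensorEnd a b := by
  -- Transported to `V ⊗ W` along `m`, the endomorphism `c` can be tested on pure tensors of vectors
  -- and of forms.
  have key : m.symm.toLinearMap.baseChange R ∘ₗ c ∘ₗ m.toLinearMap.baseChange R =
      tensorEnd a b := by
    ext x y
    refine pair_ext_tensor fun ξ η ↦ ?_
    have := h x y ξ η
    rw [← coef_tensorEnd] at this
    simpa [pair_baseChange, coef] using this
  have hm : m.toLinearMap.baseChange R ∘ₗ m.symm.toLinearMap.baseChange R = LinearMap.id := by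
    rw [← LinearMap.baseChange_comp]; simp
  rw [← key, ← LinearMap.comp_assoc, hm, LinearMap.id_comp]

/-- The endomorphism of `R ⊗ V` with given matrix coefficients. -/
def endOfCoef (c : V →ₗ[k] Module.Dual k V →ₗ[k] R) : Module.End R (R ⊗[k] V) :=
  LinearMap.liftBaseChange R
    (∑ i, (TensorProduct.mk k R V).flip (Module.Free.chooseBasis k V i) ∘ₗ
      c.flip ((Module.Free.chooseBasis k V).coord i))

@[simp]
lemma coef_endOfCoef (c : V →ₗ[k] Module.Dual k V →ₗ[k] R) (x : V) (ξ : Module.Dual k V) :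
    coef (endOfCoef c) x ξ = c x ξ := by
  simp only [coef, endOfCoef, LinearMap.liftBaseChange_tmul, one_smul, LinearMap.sum_apply,
    LinearMap.comp_apply, LinearMap.flip_apply, TensorProduct.mk_apply, map_sum, pair_tmul]
  conv_rhs => rw [← (Module.Free.chooseBasis k V).sum_dual_apply_smul_coord ξ, map_sum]
  simp

lemma coef_ext {a b : Module.End R (R ⊗[k] V)} (h : ∀ x ξ, coef a x ξ = coef b x ξ) : a = b := by
  ext x
  exact pair_ext fun ξ ↦ h x ξ

end MatrixCoefficients

/-! ### Vectors, linear forms and their products under a fibre functor -/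

namespace FibreFunctor

open Functor.LaxMonoidal Functor.OplaxMonoidal

variable {k : Type u} [Field k] {C : Type v} [Category.{w} C] [Abelian C]
    [Linear k C] [MonoidalCategory C] [SymmetricCategory C] (ω : FibreFunctor k C k)

/-- The linear map `ω(X) → ω(Y)` induced by a morphism `X → Y`. -/
def lin {X Y : C} (f : X ⟶ Y) : ω.functor.obj X →ₗ[k] ω.functor.obj Y := (ω.functor.map f).hom

@[simp] lemma lin_id (X : C) : ω.lin (𝟙 X) = LinearMap.id := by simp [lin]

lemma lin_comp {X Y Z : C} (f : X ⟶ Y) (g : Y ⟶ Z) : ω.lin (f ≫ g) = ω.lin g ∘ₗ ω.lin f := by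
  simp [lin]

lemma lin_comp_apply {X Y Z : C} (f : X ⟶ Y) (g : Y ⟶ Z) (x : ω.functor.obj X) :
    ω.lin (f ≫ g) x = ω.lin g (ω.lin f x) := by
  simp [lin]

lemma lin_add {X Y : C} (f g : X ⟶ Y) : ω.lin (f + g) = ω.lin f + ω.lin g := by
  have := ω.additive
  simp [lin, Functor.map_add]

@[simp] lemma lin_zero {X Y : C} : ω.lin (0 : X ⟶ Y) = 0 := by
  have := ω.additive
  simp [lin]

/-- `ω` followed by the forgetful functor to types preserves pullbacks. This makes `FormalCoef.Rel`
transitive and the images of morphisms stable under intersection. -/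
lemma exists_pullback {X Y Z : C} (f : X ⟶ Z) (g : Y ⟶ Z) {x : ω.functor.obj X}
    {y : ω.functor.obj Y} (h : ω.lin f x = ω.lin g y) :
    ∃ z : ω.functor.obj (Limits.pullback f g),
      ω.lin (Limits.pullback.fst f g) z = x ∧ ω.lin (Limits.pullback.snd f g) z = y := by
  have := ω.preservesFiniteLimits
  have sq := (IsPullback.of_hasPullback f g).map (ω.functor ⋙ CategoryTheory.forget (ModuleCat k))
  exact Limits.Types.exists_of_isPullback sq x y h

/-- The product of two vectors. -/
def tmul {X Y : C} (x : ω.functor.obj X) (y : ω.functor.obj Y) : ω.functor.obj (X ⊗ Y) :=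
  (μ ω.functor X Y).hom (x ⊗ₜ[k] y)

/-- The tensor product of two linear forms. -/
def dtmul {X Y : C} (ξ : Module.Dual k (ω.functor.obj X)) (η : Module.Dual k (ω.functor.obj Y)) :
    Module.Dual k (ω.functor.obj (X ⊗ Y)) :=
  dualDistrib k _ _ (ξ ⊗ₜ[k] η) ∘ₗ (δ ω.functor X Y).hom

/-- The distinguished vector of `ω(𝟙)`. -/
def one : ω.functor.obj (𝟙_ C) := (ε ω.functor).hom (1 : k)

/-- The distinguished linear form on `ω(𝟙)`. -/
def done : Module.Dual k (ω.functor.obj (𝟙_ C)) := (η ω.functor).hom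

variable {ω}

@[simp]
lemma done_one : ω.done ω.one = 1 :=
  LinearMap.congr_fun (congrArg ModuleCat.Hom.hom
    (Functor.Monoidal.ε_η ω.functor)) (1 : k)

lemma eq_done_smul_one (x : ω.functor.obj (𝟙_ C)) : x = ω.done x • ω.one := by
  have h : (ε ω.functor).hom ((η ω.functor).hom x) = x :=
    LinearMap.congr_fun (congrArg ModuleCat.Hom.hom (Functor.Monoidal.η_ε ω.functor)) x
  conv_lhs => rw [← h]
  change _ = ω.done x • (ε ω.functor).hom (1 : k)
  rw [← _root_.map_smul, smul_eq_mul, mul_one]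
  rfl

lemma δ_tmul {X Y : C} (x : ω.functor.obj X) (y : ω.functor.obj Y) :
    (δ ω.functor X Y).hom (ω.tmul x y) = x ⊗ₜ[k] y :=
  LinearMap.congr_fun (congrArg ModuleCat.Hom.hom (Functor.Monoidal.μ_δ ω.functor X Y)) _

@[simp]
lemma dtmul_tmul {X Y : C} (ξ : Module.Dual k (ω.functor.obj X))
    (η : Module.Dual k (ω.functor.obj Y)) (x : ω.functor.obj X) (y : ω.functor.obj Y) :
    ω.dtmul ξ η (ω.tmul x y) = ξ x * η y := by
  rw [dtmul, LinearMap.comp_apply, δ_tmul, dualDistrib_apply]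

lemma zero_tmul {X Y : C} (y : ω.functor.obj Y) : ω.tmul (0 : ω.functor.obj X) y = 0 := by
  rw [tmul, TensorProduct.zero_tmul, map_zero]

lemma add_tmul {X Y : C} (x x' : ω.functor.obj X) (y : ω.functor.obj Y) :
    ω.tmul (x + x') y = ω.tmul x y + ω.tmul x' y := by
  rw [tmul, TensorProduct.add_tmul, map_add]
  rfl

lemma smul_tmul {X Y : C} (c : k) (x : ω.functor.obj X) (y : ω.functor.obj Y) :
    ω.tmul (c • x) y = c • ω.tmul x y := by
  rw [tmul, ← TensorProduct.smul_tmul', _root_.map_smul]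
  rfl

@[elab_as_elim]
lemma tmul_induction {X Y : C} {p : ω.functor.obj (X ⊗ Y) → Prop} (zero : p 0)
    (tmul : ∀ x y, p (ω.tmul x y)) (add : ∀ a b, p a → p b → p (a + b))
    (z : ω.functor.obj (X ⊗ Y)) : p z := by
  have hz : (μ ω.functor X Y).hom ((δ ω.functor X Y).hom z) = z :=
    LinearMap.congr_fun (congrArg ModuleCat.Hom.hom (Functor.Monoidal.δ_μ ω.functor X Y)) z
  rw [← hz]
  generalize (δ ω.functor X Y).hom z = t
  induction t using TensorProduct.induction_on with
  | zero => rw [map_zero]; exact zero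
  | tmul x y => exact tmul x y
  | add a b ha hb => rw [map_add]; exact add _ _ ha hb

lemma hom_ext_tmul {X Y : C} {M : Type*} [AddCommGroup M] [Module k M]
    {a b : ω.functor.obj (X ⊗ Y) →ₗ[k] M} (h : ∀ x y, a (ω.tmul x y) = b (ω.tmul x y)) :
    a = b := by
  refine LinearMap.ext fun z ↦ ?_
  induction z using tmul_induction with
  | zero => simp
  | tmul x y => exact h x y
  | add a b ha hb => rw [map_add, map_add, ha, hb]

lemma lin_tensorHom {X Y X' Y' : C} (f : X ⟶ X') (g : Y ⟶ Y') (x : ω.functor.obj X)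
    (y : ω.functor.obj Y) : ω.lin (f ⊗ₘ g) (ω.tmul x y) = ω.tmul (ω.lin f x) (ω.lin g y) :=
  (LinearMap.congr_fun (congrArg ModuleCat.Hom.hom (μ_natural ω.functor f g)) (x ⊗ₜ y)).symm

lemma dtmul_comp {X Y X' Y' : C} (f : X ⟶ X') (g : Y ⟶ Y')
    (ξ : Module.Dual k (ω.functor.obj X')) (η : Module.Dual k (ω.functor.obj Y')) :
    ω.dtmul ξ η ∘ₗ ω.lin (f ⊗ₘ g) = ω.dtmul (ξ ∘ₗ ω.lin f) (η ∘ₗ ω.lin g) :=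
  hom_ext_tmul fun x y ↦ by simp [lin_tensorHom]

lemma lin_associator {X Y Z : C} (x : ω.functor.obj X) (y : ω.functor.obj Y)
    (z : ω.functor.obj Z) :
    ω.lin (α_ X Y Z).hom (ω.tmul (ω.tmul x y) z) = ω.tmul x (ω.tmul y z) :=
  LinearMap.congr_fun (congrArg ModuleCat.Hom.hom (Functor.LaxMonoidal.associativity ω.functor X Y Z))
    ((x ⊗ₜ y) ⊗ₜ z)

lemma lin_braiding {X Y : C} (x : ω.functor.obj X) (y : ω.functor.obj Y) :
    ω.lin (β_ X Y).hom (ω.tmul x y) = ω.tmul y x :=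
  LinearMap.congr_fun (congrArg ModuleCat.Hom.hom
    (Functor.LaxBraided.braided (F := ω.functor) X Y)) (x ⊗ₜ y)

lemma lin_leftUnitor {X : C} (x : ω.functor.obj X) :
    ω.lin (λ_ X).hom (ω.tmul ω.one x) = x := by
  have := LinearMap.congr_fun (congrArg ModuleCat.Hom.hom
    (Functor.LaxMonoidal.left_unitality ω.functor X))
    ((1 : k) ⊗ₜ x)
  refine this.symm.trans ?_
  exact one_smul k x

lemma lin_rightUnitor {X : C} (x : ω.functor.obj X) :
    ω.lin (ρ_ X).hom (ω.tmul x ω.one) = x := by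
  have := LinearMap.congr_fun (congrArg ModuleCat.Hom.hom
    (Functor.LaxMonoidal.right_unitality ω.functor X)) (x ⊗ₜ (1 : k))
  refine this.symm.trans ?_
  exact one_smul k x

lemma lin_whiskerRight {X X' Y : C} (f : X ⟶ X') (x : ω.functor.obj X) (y : ω.functor.obj Y) :
    ω.lin (f ▷ Y) (ω.tmul x y) = ω.tmul (ω.lin f x) y := by
  rw [← MonoidalCategory.tensorHom_id, lin_tensorHom, lin_id, LinearMap.id_apply]

lemma lin_whiskerLeft {X Y Y' : C} (f : Y ⟶ Y') (x : ω.functor.obj X) (y : ω.functor.obj Y) :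
    ω.lin (X ◁ f) (ω.tmul x y) = ω.tmul x (ω.lin f y) := by
  rw [← MonoidalCategory.id_tensorHom, lin_tensorHom, lin_id, LinearMap.id_apply]

lemma tmul_smul {X Y : C} (c : k) (x : ω.functor.obj X) (y : ω.functor.obj Y) :
    ω.tmul x (c • y) = c • ω.tmul x y := by
  rw [tmul, TensorProduct.tmul_smul, _root_.map_smul]
  rfl

lemma sum_tmul {X Y : C} {ι : Type*} (s : Finset ι) (x : ι → ω.functor.obj X)
    (y : ω.functor.obj Y) : ω.tmul (∑ i ∈ s, x i) y = ∑ i ∈ s, ω.tmul (x i) y := by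
  rw [tmul, TensorProduct.sum_tmul, map_sum]
  rfl

end FibreFunctor

/-! ### The algebra of matrix coefficients -/

section CoefficientRing

variable {k : Type u} [Field k] {C : Type v} [Category.{w} C] [Abelian C]
    [Linear k C] [MonoidalCategory C] [SymmetricCategory C]

/-- A formal matrix coefficient of a fibre functor: a vector and a linear form on some `ω(X)`. -/
structure FormalCoef (ω : FibreFunctor k C k) where
  /-- The object. -/
  X : C
  /-- The vector. -/
  x : ω.functor.obj X
  /-- The linear form. -/
  ξ : Module.Dual k (ω.functor.obj X)

namespace FormalCoef

variable {ω : FibreFunctor k C k}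

/-- Two formal coefficients are equivalent if they agree on an object mapping to both. -/
def Rel (a b : FormalCoef ω) : Prop :=
  ∃ (Z : C) (z : ω.functor.obj Z) (f : Z ⟶ a.X) (g : Z ⟶ b.X),
    ω.lin f z = a.x ∧ ω.lin g z = b.x ∧ a.ξ ∘ₗ ω.lin f = b.ξ ∘ₗ ω.lin g

/-- For transitivity, the two spans are composed through a pullback, in which `z` and `z'` have a
common lift. -/
lemma rel_equivalence : Equivalence (Rel (ω := ω)) where
  refl a := ⟨a.X, a.x, 𝟙 _, 𝟙 _, by simp, by simp, rfl⟩
  symm := fun ⟨Z, z, f, g, hf, hg, h⟩ ↦ ⟨Z, z, g, f, hg, hf, h.symm⟩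
  trans := fun ⟨Z, z, f, g, hf, hg, h⟩ ⟨Z', z', f', g', hf', hg', h'⟩ ↦ by
    obtain ⟨t, ht, ht'⟩ := ω.exists_pullback g f' (hg.trans hf'.symm)
    refine ⟨_, t, Limits.pullback.fst g f' ≫ f, Limits.pullback.snd g f' ≫ g', ?_, ?_, ?_⟩
    · rw [ω.lin_comp_apply, ht, hf]
    · rw [ω.lin_comp_apply, ht', hg']
    · rw [ω.lin_comp, ω.lin_comp, ← LinearMap.comp_assoc, h, ← LinearMap.comp_assoc, ← h',
        LinearMap.comp_assoc, LinearMap.comp_assoc, ← ω.lin_comp, ← ω.lin_comp,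
        Limits.pullback.condition]

instance setoid (ω : FibreFunctor k C k) : Setoid (FormalCoef ω) := ⟨Rel, rel_equivalence⟩

end FormalCoef

/-- The ring of matrix coefficients of a fibre functor. -/
def CoefRing (ω : FibreFunctor k C k) : Type max u v := Quotient (FormalCoef.setoid ω)

namespace CoefRing

variable {ω : FibreFunctor k C k}

/-- The matrix coefficient attached to a vector and a linear form on `ω(X)`. -/
def mk {X : C} (x : ω.functor.obj X) (ξ : Module.Dual k (ω.functor.obj X)) : CoefRing ω :=
  Quotient.mk _ ⟨X, x, ξ⟩

lemma ind {p : CoefRing ω → Prop}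
    (h : ∀ (X : C) (x : ω.functor.obj X) (ξ : Module.Dual k (ω.functor.obj X)), p (mk x ξ))
    (a : CoefRing ω) : p a :=
  Quotient.ind (fun a ↦ h a.X a.x a.ξ) a

/-- This is the sliding relation of the coend of `ω(X) ⊗ ω(X)^∨`; the span has an identity as one
leg. -/
lemma mk_lin {X Y : C} (f : X ⟶ Y) (x : ω.functor.obj X) (η : Module.Dual k (ω.functor.obj Y)) :
    mk (ω.lin f x) η = mk x (η ∘ₗ ω.lin f) :=
  Quotient.sound ⟨X, x, f, 𝟙 X, rfl, by simp, by simp⟩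

lemma mk_eq_mk {X Y : C} {x : ω.functor.obj X} {ξ : Module.Dual k (ω.functor.obj X)}
    {y : ω.functor.obj Y} {η : Module.Dual k (ω.functor.obj Y)} :
    mk x ξ = mk y η ↔ ∃ (Z : C) (z : ω.functor.obj Z) (f : Z ⟶ X) (g : Z ⟶ Y),
      ω.lin f z = x ∧ ω.lin g z = y ∧ ξ ∘ₗ ω.lin f = η ∘ₗ ω.lin g :=
  ⟨fun h ↦ Quotient.exact h, fun h ↦ Quotient.sound h⟩

/-- To give a function on the ring of coefficients is to give an invariant function of the
formal coefficients. -/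
def lift {M : Type*} (c : ∀ X : C, ω.functor.obj X → Module.Dual k (ω.functor.obj X) → M)
    (hc : ∀ {X Y : C} (f : X ⟶ Y) x η, c Y (ω.lin f x) η = c X x (η ∘ₗ ω.lin f)) :
    CoefRing ω → M :=
  Quotient.lift (fun a ↦ c a.X a.x a.ξ) <| by
    rintro ⟨X, x, ξ⟩ ⟨Y, y, η⟩ ⟨Z, z, f, g, hf, hg, h⟩
    exact (congrArg (c X · ξ) hf).symm.trans ((hc f z ξ).trans ((congrArg _ h).trans
      ((hc g z η).symm.trans (congrArg (c Y · η) hg))))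

@[simp]
lemma lift_mk {M : Type*} (c : ∀ X : C, ω.functor.obj X → Module.Dual k (ω.functor.obj X) → M)
    (hc : ∀ {X Y : C} (f : X ⟶ Y) x η, c Y (ω.lin f x) η = c X x (η ∘ₗ ω.lin f))
    {X : C} (x : ω.functor.obj X) (ξ : Module.Dual k (ω.functor.obj X)) :
    lift c hc (mk x ξ) = c X x ξ := rfl

-- The sum is the coefficient of the direct sum. A morphism in one variable slides through
-- `biprod.map` with the identity on the other summand.
open Limits in
instance : Add (CoefRing ω) where
  add a b := lift (fun X x ξ ↦ lift (fun Y y η ↦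
      mk (ω.lin (biprod.inl : X ⟶ X ⊞ Y) x + ω.lin (biprod.inr : Y ⟶ X ⊞ Y) y)
        (ξ ∘ₗ ω.lin biprod.fst + η ∘ₗ ω.lin biprod.snd))
      (fun {Y Y'} f y η ↦ by
        have h1 : (biprod.inl : X ⟶ X ⊞ Y) ≫ biprod.map (𝟙 X) f = biprod.inl := by simp
        have h2 : (biprod.inr : Y ⟶ X ⊞ Y) ≫ biprod.map (𝟙 X) f = f ≫ biprod.inr := by simp
        rw [← ω.lin_comp_apply, ← h2, ← h1, ω.lin_comp_apply, ω.lin_comp_apply, ← map_add, mk_lin,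
          LinearMap.add_comp, LinearMap.comp_assoc, LinearMap.comp_assoc, LinearMap.comp_assoc,
          ← ω.lin_comp, ← ω.lin_comp, ← ω.lin_comp]
        simp) b)
    (fun {X X'} f x ξ ↦ by
      induction b using ind with | h Y y η =>
      have h1 : (biprod.inl : X ⟶ X ⊞ Y) ≫ biprod.map f (𝟙 Y) = f ≫ biprod.inl := by simp
      have h2 : (biprod.inr : Y ⟶ X ⊞ Y) ≫ biprod.map f (𝟙 Y) = biprod.inr := by simp
      simp only [lift_mk]
      rw [← ω.lin_comp_apply, ← h2, ← h1, ω.lin_comp_apply, ω.lin_comp_apply, ← map_add, mk_lin,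
        LinearMap.add_comp, LinearMap.comp_assoc, LinearMap.comp_assoc, LinearMap.comp_assoc,
        ← ω.lin_comp, ← ω.lin_comp, ← ω.lin_comp]
      simp) a

instance : Zero (CoefRing ω) := ⟨mk (X := 𝟙_ C) 0 0⟩

instance : One (CoefRing ω) := ⟨mk ω.one ω.done⟩

lemma one_def : (1 : CoefRing ω) = mk ω.one ω.done := rfl

instance : SMul k (CoefRing ω) where
  smul c := lift (fun _ x ξ ↦ mk x (c • ξ)) fun f x η ↦ mk_lin f x (c • η)

lemma smul_mk (c : k) {X : C} (x : ω.functor.obj X) (ξ : Module.Dual k (ω.functor.obj X)) :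
    c • mk x ξ = mk x (c • ξ) := rfl

instance : Mul (CoefRing ω) where
  mul a b := lift (fun X x ξ ↦ lift (fun Y y η ↦ mk (ω.tmul x y) (ω.dtmul ξ η))
      (fun f y η ↦ by
        have h := FibreFunctor.lin_tensorHom (ω := ω) (𝟙 X) f x y
        rw [ω.lin_id, LinearMap.id_apply] at h
        rw [← h, mk_lin, FibreFunctor.dtmul_comp]
        simp) b)
    (fun f x ξ ↦ by
      induction b using ind with | h Y y η =>
      have h := FibreFunctor.lin_tensorHom (ω := ω) f (𝟙 Y) x y
      rw [ω.lin_id, LinearMap.id_apply] at h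
      simp only [lift_mk]
      rw [← h, mk_lin, FibreFunctor.dtmul_comp]
      simp) a

lemma mk_mul_mk {X Y : C} (x : ω.functor.obj X) (ξ : Module.Dual k (ω.functor.obj X))
    (y : ω.functor.obj Y) (η : Module.Dual k (ω.functor.obj Y)) :
    mk x ξ * mk y η = mk (ω.tmul x y) (ω.dtmul ξ η) := rfl

open Limits in
lemma mk_add_mk {X Y : C} (x : ω.functor.obj X) (ξ : Module.Dual k (ω.functor.obj X))
    (y : ω.functor.obj Y) (η : Module.Dual k (ω.functor.obj Y)) :
    mk x ξ + mk y η = mk (ω.lin (biprod.inl : X ⟶ X ⊞ Y) x + ω.lin (biprod.inr : Y ⟶ X ⊞ Y) y)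
      (ξ ∘ₗ ω.lin biprod.fst + η ∘ₗ ω.lin biprod.snd) := rfl

-- The vector `(x, x)` is the image of `x` under the diagonal, which slides over to the forms. For
-- `mk_add_left` the codiagonal plays the dual role.
open Limits in
lemma mk_add_right {X : C} (x : ω.functor.obj X) (ξ η : Module.Dual k (ω.functor.obj X)) :
    mk x (ξ + η) = mk x ξ + mk x η := by
  have h : ω.lin (biprod.inl : X ⟶ X ⊞ X) x + ω.lin (biprod.inr : X ⟶ X ⊞ X) x =
      ω.lin (biprod.lift (𝟙 X) (𝟙 X)) x := by
    rw [← LinearMap.add_apply, ← ω.lin_add]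
    congr 2
    ext <;> simp
  rw [mk_add_mk, h, mk_lin, LinearMap.add_comp, LinearMap.comp_assoc, LinearMap.comp_assoc,
    ← ω.lin_comp, ← ω.lin_comp]
  simp

open Limits in
lemma mk_add_left {X : C} (x y : ω.functor.obj X) (ξ : Module.Dual k (ω.functor.obj X)) :
    mk (x + y) ξ = mk x ξ + mk y ξ := by
  have h : ξ ∘ₗ ω.lin (biprod.fst : X ⊞ X ⟶ X) + ξ ∘ₗ ω.lin (biprod.snd : X ⊞ X ⟶ X) =
      ξ ∘ₗ ω.lin (biprod.desc (𝟙 X) (𝟙 X)) := by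
    rw [← LinearMap.comp_add, ← ω.lin_add]
    congr 2
    ext <;> simp
  rw [mk_add_mk, h, ← mk_lin, map_add, ← ω.lin_comp_apply, ← ω.lin_comp_apply]
  simp

lemma mk_smul_left (c : k) {X : C} (x : ω.functor.obj X) (ξ : Module.Dual k (ω.functor.obj X)) :
    mk (c • x) ξ = c • mk x ξ := by
  have := ω.additive
  have h : ω.lin (c • 𝟙 X) = c • LinearMap.id := by
    rw [FibreFunctor.lin, ω.map_smul]
    simp
  have h1 : c • x = ω.lin (c • 𝟙 X) x := by rw [h]; rfl
  rw [h1, mk_lin, h, smul_mk, LinearMap.comp_smul,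
    LinearMap.comp_id]

@[simp] lemma mk_zero_right {X : C} (x : ω.functor.obj X) : mk (ω := ω) x 0 = 0 := by
  have h1 : mk x 0 = mk (0 : ω.functor.obj (𝟙_ C)) (0 : Module.Dual k _) := by
    have := mk_lin (0 : X ⟶ 𝟙_ C) x (0 : Module.Dual k (ω.functor.obj (𝟙_ C)))
    rw [ω.lin_zero, LinearMap.zero_apply, LinearMap.comp_zero] at this
    exact this.symm
  exact h1

open Limits in
/-- Two coefficients have a common vector. -/
lemma exists_common {X Y : C} (x : ω.functor.obj X) (y : ω.functor.obj Y) :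
    ∃ (Z : C) (z : ω.functor.obj Z) (f : Z ⟶ X) (g : Z ⟶ Y),
      ω.lin f z = x ∧ ω.lin g z = y := by
  refine ⟨X ⊞ Y, ω.lin biprod.inl x + ω.lin biprod.inr y, biprod.fst, biprod.snd, ?_, ?_⟩ <;>
  · rw [map_add, ← ω.lin_comp_apply, ← ω.lin_comp_apply]
    simp

/-- When the vector is shared, sums of coefficients are sums of forms, so the additive axioms reduce
to those of a dual space. -/
lemma ind₂ {p : CoefRing ω → CoefRing ω → Prop}
    (h : ∀ (X : C) (x : ω.functor.obj X) (ξ η : Module.Dual k (ω.functor.obj X)),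
      p (mk x ξ) (mk x η)) (a b : CoefRing ω) : p a b := by
  induction a using ind with | h X x ξ =>
  induction b using ind with | h Y y η =>
  obtain ⟨Z, z, f, g, rfl, rfl⟩ := exists_common x y
  rw [mk_lin, mk_lin]
  exact h _ _ _ _

lemma ind₃ {p : CoefRing ω → CoefRing ω → CoefRing ω → Prop}
    (h : ∀ (X : C) (x : ω.functor.obj X) (ξ η ζ : Module.Dual k (ω.functor.obj X)),
      p (mk x ξ) (mk x η) (mk x ζ)) (a b c : CoefRing ω) : p a b c := by
  induction a, b using ind₂ with | h X x ξ η =>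
  induction c using ind with | h Y y ζ =>
  obtain ⟨Z, z, f, g, rfl, rfl⟩ := exists_common x y
  rw [mk_lin, mk_lin, mk_lin]
  exact h _ _ _ _ _

instance : Neg (CoefRing ω) := ⟨fun a ↦ (-1 : k) • a⟩

instance : AddCommGroup (CoefRing ω) where
  add_assoc a b c := by
    induction a, b, c using ind₃ with | h X x ξ η ζ =>
    simp only [← mk_add_right, add_assoc]
  zero_add a := by
    induction a using ind with | h X x ξ =>
    rw [← mk_zero_right x, ← mk_add_right, zero_add]
  add_zero a := by
    induction a using ind with | h X x ξ =>
    rw [← mk_zero_right x, ← mk_add_right, add_zero]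
  add_comm a b := by
    induction a, b using ind₂ with | h X x ξ η =>
    rw [← mk_add_right, add_comm, mk_add_right]
  neg_add_cancel a := by
    induction a using ind with | h X x ξ =>
    have h : (-1 : k) • ξ + ξ = 0 := by
      have := (add_smul (-1 : k) 1 ξ).symm
      rwa [neg_add_cancel, zero_smul, one_smul] at this
    exact (mk_add_right x _ ξ).symm.trans ((congrArg (mk x) h).trans (mk_zero_right x))
  nsmul := nsmulRec
  zsmul := zsmulRec

lemma dtmul_add {X Y : C} (ξ : Module.Dual k (ω.functor.obj X))
    (η η' : Module.Dual k (ω.functor.obj Y)) :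
    ω.dtmul ξ (η + η') = ω.dtmul ξ η + ω.dtmul ξ η' :=
  FibreFunctor.hom_ext_tmul fun x y ↦ by simp [mul_add]

lemma dtmul_smul {X Y : C} (c : k) (ξ : Module.Dual k (ω.functor.obj X))
    (η : Module.Dual k (ω.functor.obj Y)) :
    ω.dtmul ξ (c • η) = c • ω.dtmul ξ η :=
  FibreFunctor.hom_ext_tmul fun x y ↦ by simp [mul_left_comm]

protected lemma mul_comm (a b : CoefRing ω) : a * b = b * a := by
  induction a using ind with | h X x ξ =>
  induction b using ind with | h Y y η =>
  have h : ω.dtmul ξ η = ω.dtmul η ξ ∘ₗ ω.lin (β_ X Y).hom :=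
    FibreFunctor.hom_ext_tmul fun x y ↦ by simp [FibreFunctor.lin_braiding, mul_comm]
  rw [mk_mul_mk, mk_mul_mk, h, ← mk_lin, FibreFunctor.lin_braiding]

protected lemma mul_add (a b c : CoefRing ω) : a * (b + c) = a * b + a * c := by
  induction a using ind with | h X x ξ =>
  induction b, c using ind₂ with | h Y y η ζ =>
  rw [← mk_add_right, mk_mul_mk, mk_mul_mk, mk_mul_mk, ← mk_add_right, dtmul_add]

protected lemma one_mul (a : CoefRing ω) : 1 * a = a := by
  induction a using ind with | h X x ξ =>
  have h : ω.dtmul ω.done ξ = ξ ∘ₗ ω.lin (λ_ X).hom :=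
    FibreFunctor.hom_ext_tmul fun x y ↦ by
      rw [LinearMap.comp_apply, FibreFunctor.dtmul_tmul]
      conv_rhs => rw [FibreFunctor.eq_done_smul_one x]
      rw [FibreFunctor.smul_tmul, _root_.map_smul, _root_.map_smul,
        FibreFunctor.lin_leftUnitor, smul_eq_mul]
  rw [one_def, mk_mul_mk, h, ← mk_lin, FibreFunctor.lin_leftUnitor]

instance : CommRing (CoefRing ω) where
  left_distrib := CoefRing.mul_add
  right_distrib a b c := by
    rw [CoefRing.mul_comm, CoefRing.mul_add, CoefRing.mul_comm c, CoefRing.mul_comm c]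
  zero_mul a := by
    induction a using ind with | h X x ξ =>
    change mk _ _ * mk _ _ = 0
    rw [mk_mul_mk]
    convert mk_zero_right _
    exact FibreFunctor.hom_ext_tmul fun x y ↦ by simp
  mul_zero a := by
    induction a using ind with | h X x ξ =>
    change mk _ _ * mk _ _ = 0
    rw [mk_mul_mk]
    convert mk_zero_right _
    exact FibreFunctor.hom_ext_tmul fun x y ↦ by simp
  mul_assoc a b c := by
    induction a using ind with | h X x ξ =>
    induction b using ind with | h Y y η =>
    induction c using ind with | h Z z ζ =>
    have h : ω.dtmul (ω.dtmul ξ η) ζ = ω.dtmul ξ (ω.dtmul η ζ) ∘ₗ ω.lin (α_ X Y Z).hom := by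
      refine FibreFunctor.hom_ext_tmul fun p z ↦ ?_
      induction p using FibreFunctor.tmul_induction with
      | tmul x y => simp [FibreFunctor.lin_associator, mul_assoc]
      | add p q hp hq => simp only [FibreFunctor.add_tmul, map_add, hp, hq]
      | zero => simp only [FibreFunctor.zero_tmul, map_zero]
    rw [mk_mul_mk, mk_mul_mk, mk_mul_mk, mk_mul_mk, h, ← mk_lin, FibreFunctor.lin_associator]
  one_mul := CoefRing.one_mul
  mul_one a := by rw [CoefRing.mul_comm, CoefRing.one_mul]
  mul_comm := CoefRing.mul_comm
  zsmul := zsmulRec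
  neg_add_cancel := neg_add_cancel

instance : Module k (CoefRing ω) where
  one_smul a := by
    induction a using ind with | h X x ξ =>
    rw [smul_mk, one_smul]
  mul_smul c d a := by
    induction a using ind with | h X x ξ =>
    rw [smul_mk, smul_mk, smul_mk, mul_smul]
  smul_zero c := by
    rw [← mk_zero_right (ω.one), smul_mk, smul_zero]
  smul_add c a b := by
    induction a, b using ind₂ with | h X x ξ η =>
    rw [← mk_add_right, smul_mk, smul_mk, smul_mk, smul_add, mk_add_right]
  add_smul c d a := by
    induction a using ind with | h X x ξ =>
    rw [smul_mk, smul_mk, smul_mk, add_smul, mk_add_right]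
  zero_smul a := by
    induction a using ind with | h X x ξ =>
    rw [smul_mk, zero_smul, mk_zero_right]

protected lemma mul_smul_comm' (c : k) (a b : CoefRing ω) : a * c • b = c • (a * b) := by
  induction a using ind with | h X x ξ =>
  induction b using ind with | h Y y η =>
  rw [smul_mk, mk_mul_mk, mk_mul_mk, smul_mk, dtmul_smul]

instance : Algebra k (CoefRing ω) :=
  Algebra.ofModule (fun c a b ↦ by rw [mul_comm, CoefRing.mul_smul_comm', mul_comm])
    CoefRing.mul_smul_comm'

/-- The bilinear map that sends a vector and a linear form to the matrix coefficient. -/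
def mkBilin (ω : FibreFunctor k C k) (X : C) :
    ω.functor.obj X →ₗ[k] Module.Dual k (ω.functor.obj X) →ₗ[k] CoefRing ω :=
  LinearMap.mk₂ k mk mk_add_left (fun c x ξ ↦ mk_smul_left c x ξ) mk_add_right fun _ _ _ ↦ rfl

@[simp] lemma mkBilin_apply {X : C} (x : ω.functor.obj X)
    (ξ : Module.Dual k (ω.functor.obj X)) : mkBilin ω X x ξ = mk x ξ := rfl

/-- Zero is also the class of the pair `(x, 0)`, so `mk_eq_mk` applies and only one leg of the span
matters. This turns the vanishing of a coefficient into a morphism of `C`. -/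
lemma mk_eq_zero_iff {X : C} {x : ω.functor.obj X} {ξ : Module.Dual k (ω.functor.obj X)} :
    mk x ξ = 0 ↔ ∃ (Z : C) (z : ω.functor.obj Z) (f : Z ⟶ X), ω.lin f z = x ∧
      ξ ∘ₗ ω.lin f = 0 := by
  constructor
  · intro h
    rw [← mk_zero_right x, mk_eq_mk] at h
    obtain ⟨Z, z, f, g, hf, hg, h⟩ := h
    exact ⟨Z, z, f, hf, by simpa using h⟩
  · rintro ⟨Z, z, f, rfl, h⟩
    rw [mk_lin, h, mk_zero_right]

/-- The representing algebra has to live in the universe of `k`. Every coefficient can be moved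
along an isomorphism to an object of the small model. -/
instance [EssentiallySmall.{u} C] : Small.{u} (CoefRing ω) := by
  let E := equivSmallModel.{u} C
  let s : (Σ X : SmallModel.{u} C, ω.functor.obj (E.inverse.obj X) ×
      Module.Dual k (ω.functor.obj (E.inverse.obj X))) → CoefRing ω := fun p ↦ mk p.2.1 p.2.2
  refine small_of_surjective (f := s) fun a ↦ ?_
  induction a using ind with | h X x ξ =>
  let e : X ≅ E.inverse.obj (E.functor.obj X) := E.unitIso.app X
  refine ⟨⟨E.functor.obj X, ω.lin e.hom x, ξ ∘ₗ ω.lin e.inv⟩, ?_⟩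
  change mk _ _ = _
  rw [mk_lin, LinearMap.comp_assoc, ← ω.lin_comp]
  simp

end CoefRing

end CoefficientRing

/-! ### Tensor automorphisms as algebra maps out of the coefficients -/

section Representability

open Functor.LaxMonoidal Functor.OplaxMonoidal

variable {k : Type u} [Field k] {C : Type v} [Category.{w} C] [Abelian C]
    [Linear k C] [MonoidalCategory C] [SymmetricCategory C]
    {R : Type u} [CommRing R] [Algebra k R] {S : Type u} [CommRing S] [Algebra k S]

/-- The matrix coefficients of a tensor automorphism of `ω ⊗ R` define a homomorphism from the
ring of coefficients to `R`. -/
def algHomOfAut (ω : FibreFunctor k C k) (a : tensorAut ω R) : CoefRing ω →ₐ[k] R :=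
  let φ : CoefRing ω → R := CoefRing.lift (fun X x ξ ↦ coef (a.1 X).val x ξ)
    fun f x η ↦ coef_comm (a.2.1 f) x η
  have hmk : ∀ {X : C} (x : ω.functor.obj X) ξ, φ (CoefRing.mk x ξ) = coef (a.1 X).val x ξ :=
    fun _ _ ↦ rfl
  have hone : φ 1 = 1 := by
    rw [CoefRing.one_def, hmk]
    have h := coef_comm (a := 1) (b := (a.1 (𝟙_ C)).val) (h := (ε ω.functor).hom) a.2.2.1 (1 : k)
      ω.done
    refine h.trans ((coef_one (R := R) (1 : k) _).trans ?_)
    have : (ω.done ∘ₗ (ε ω.functor).hom) (1 : k) = 1 := FibreFunctor.done_one (ω := ω)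
    rw [this, map_one]
  have hsmul : ∀ (c : k) p, φ (c • p) = c • φ p := fun c p ↦ by
    induction p using CoefRing.ind with | h X x ξ =>
    rw [CoefRing.smul_mk, hmk, hmk, coef_smul_right]
  have hadd : ∀ p q, φ (p + q) = φ p + φ q := fun p q ↦ by
    induction p, q using CoefRing.ind₂ with | h X x ξ η =>
    rw [← CoefRing.mk_add_right, hmk, hmk, hmk, coef_add_right]
  have hmul : ∀ p q, φ (p * q) = φ p * φ q := fun p q ↦ by
    induction p using CoefRing.ind with | h X x ξ =>
    induction q using CoefRing.ind with | h Y y η =>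
    rw [CoefRing.mk_mul_mk, hmk, hmk, hmk, ← coef_tensorEnd]
    refine (coef_comm (a.2.2.2 X Y) (x ⊗ₜ y) (ω.dtmul ξ η)).trans ?_
    congr 1
    exact TensorProduct.ext' fun x y ↦ FibreFunctor.dtmul_tmul ξ η x y
  AlgHom.ofLinearMap { toFun := φ, map_add' := hadd, map_smul' := hsmul } hone hmul

/-- The endomorphism of `R ⊗ ω(X)` defined by a homomorphism from the ring of coefficients. -/
def endOfAlgHom [TensorialCategory k C] {ω : FibreFunctor k C k} (φ : CoefRing ω →ₐ[k] R) (X : C) :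
    Module.End R (R ⊗[k] ω.functor.obj X) :=
  have := finite_obj ω X
  endOfCoef ((CoefRing.mkBilin ω X).compr₂ φ.toLinearMap)

variable [TensorialCategory k C] {ω : FibreFunctor k C k}

@[simp]
lemma coef_endOfAlgHom (φ : CoefRing ω →ₐ[k] R) {X : C} (x : ω.functor.obj X)
    (ξ : Module.Dual k (ω.functor.obj X)) :
    coef (endOfAlgHom φ X) x ξ = φ (CoefRing.mk x ξ) := by
  have := finite_obj ω X
  simp [endOfAlgHom]

/-- `b` is a surjective endomorphism of a finite module over a commutative ring, hence bijective. So
a one-sided inverse suffices. -/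
lemma isUnit_of_mul_eq_one {V : Type u} [AddCommGroup V] [Module k V] [Module.Finite k V]
    {a b : Module.End R (R ⊗[k] V)} (h : b * a = 1) : IsUnit a := by
  have hb : Function.Surjective b := fun x ↦ ⟨a x, LinearMap.congr_fun h x⟩
  have hbij := OrzechProperty.bijective_of_surjective_endomorphism b hb
  have hba : IsUnit b := (Module.End.isUnit_iff b).2 hbij
  obtain ⟨u, rfl⟩ := hba
  rw [Units.mul_eq_one_iff_inv_eq] at h
  exact h ▸ Units.isUnit _

/-- The inverse is the endomorphism attached to a dual `Y`, transposed to `ω(X)` by evaluation and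
coevaluation. That it is an inverse follows from the invariance of the evaluation (`hp`) and a
zigzag identity (`hzig`). -/
lemma isUnit_endOfAlgHom (φ : CoefRing ω →ₐ[k] R) (X : C) : IsUnit (endOfAlgHom φ X) := by
  have := finite_obj ω X
  obtain ⟨Y, ⟨_⟩⟩ := TensorialCategory.exists_dual (k := k) X
  let e : Module.Dual k (ω.functor.obj (Y ⊗ X)) := ω.done ∘ₗ ω.lin (ε_ X Y)
  let eL : ω.functor.obj X →ₗ[k] Module.Dual k (ω.functor.obj Y) :=
    (TensorProduct.mk k _ _).flip.compr₂ (e ∘ₗ (μ ω.functor Y X).hom)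
  have heL : ∀ x y, eL x y = e (ω.tmul y x) := fun _ _ ↦ rfl
  obtain ⟨s, hs⟩ := TensorProduct.exists_finset (R := k)
    ((δ ω.functor X Y).hom (ω.lin (η_ X Y) ω.one))
  have hs' : ω.lin (η_ X Y) ω.one = ∑ p ∈ s, ω.tmul p.1 p.2 := by
    have := congrArg (μ ω.functor X Y).hom hs
    rw [map_sum] at this
    rw [show ∑ p ∈ s, ω.tmul p.1 p.2 = _ from this.symm]
    exact (LinearMap.congr_fun (congrArg ModuleCat.Hom.hom (Functor.Monoidal.δ_μ ω.functor X Y))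
      (ω.lin (η_ X Y) ω.one)).symm
  -- The zigzag identity in coordinates, the pairs in `s` being the pure tensors of the
  -- coevaluation.
  have hzig : ∀ x : ω.functor.obj X, ∑ p ∈ s, e (ω.tmul p.2 x) • p.1 = x := fun x ↦ by
    have h := congrArg (fun f ↦ ω.lin f (ω.tmul ω.one x))
      (ExactPairing.evaluation_coevaluation_assoc X Y (ρ_ X).hom)
    simp only [Iso.inv_hom_id, Category.comp_id, FibreFunctor.lin_leftUnitor,
      ω.lin_comp_apply, FibreFunctor.lin_whiskerRight, hs', FibreFunctor.sum_tmul, map_sum,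
      FibreFunctor.lin_associator, FibreFunctor.lin_whiskerLeft] at h
    refine Eq.trans ?_ h
    refine Finset.sum_congr rfl fun p _ ↦ ?_
    rw [FibreFunctor.eq_done_smul_one (ω.lin (ε_ X Y) _), FibreFunctor.tmul_smul,
      _root_.map_smul, FibreFunctor.lin_rightUnitor]
    rfl
  -- Coefficients of the transpose: in each tensor `p.1 ⊗ p.2` of the coevaluation, `φ` acts on
  -- `p.2`, and the result is paired with `x`.
  let c : ω.functor.obj X →ₗ[k] Module.Dual k (ω.functor.obj X) →ₗ[k] R :=
    ∑ p ∈ s, LinearMap.compr₂ (LinearMap.mk₂ k (fun x (ξ : Module.Dual k (ω.functor.obj X)) ↦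
      ξ p.1 • CoefRing.mkBilin ω Y p.2 (eL x)) (fun x y ξ ↦ by simp only [map_add, smul_add])
      (fun c x ξ ↦ by simp only [_root_.map_smul, smul_comm c])
      (fun x ξ η ↦ by simp only [LinearMap.add_apply, add_smul])
      (fun c x ξ ↦ by simp only [LinearMap.smul_apply, smul_assoc])) φ.toLinearMap
  refine isUnit_of_mul_eq_one (b := endOfCoef c) (coef_ext fun x ξ ↦ ?_)
  rw [coef_mul _ _ (Module.finBasis k (ω.functor.obj X)), coef_one]
  -- The sum is the coefficient of `y ⊗ x` at the form `e`, which factors through the evaluation `Y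
  -- ⊗ X ⟶ 𝟙`. Sliding the evaluation to the vector leaves a coefficient of `𝟙`, a scalar.
  have hp : ∀ y : ω.functor.obj Y, ∑ i, CoefRing.mk x ((Module.finBasis k _).coord i) *
      CoefRing.mk y (eL (Module.finBasis k _ i)) =
        algebraMap k (CoefRing ω) (e (ω.tmul y x)) := fun y ↦ by
    have he : ∑ i, ω.dtmul (eL (Module.finBasis k (ω.functor.obj X) i))
        ((Module.finBasis k (ω.functor.obj X)).coord i) = e :=
      FibreFunctor.hom_ext_tmul fun y x ↦ by
        simp only [LinearMap.sum_apply, FibreFunctor.dtmul_tmul, Module.Basis.coord_apply]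
        rw [← heL]
        conv_rhs => rw [← (Module.finBasis k (ω.functor.obj X)).sum_repr x, map_sum]
        simp [LinearMap.sum_apply, mul_comm]
    calc _ = ∑ i, CoefRing.mkBilin ω (Y ⊗ X) (ω.tmul y x)
          (ω.dtmul (eL (Module.finBasis k (ω.functor.obj X) i))
            ((Module.finBasis k (ω.functor.obj X)).coord i)) :=
          Finset.sum_congr rfl fun i _ ↦ by
            rw [mul_comm, CoefRing.mk_mul_mk, CoefRing.mkBilin_apply]
      _ = CoefRing.mk (ω.tmul y x) (ω.done ∘ₗ ω.lin (ε_ X Y)) := by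
          rw [← map_sum, he, CoefRing.mkBilin_apply]
      _ = _ := by
          rw [← CoefRing.mk_lin, FibreFunctor.eq_done_smul_one (ω.lin (ε_ X Y) _),
            CoefRing.mk_smul_left, ← CoefRing.one_def, Algebra.algebraMap_eq_smul_one]
          rfl
  have hc : ∀ x ξ, c x ξ = ∑ p ∈ s, ξ p.1 • φ (CoefRing.mk p.2 (eL x)) := fun x ξ ↦ by
    simp [c, LinearMap.sum_apply]
  simp only [coef_endOfAlgHom, coef_endOfCoef, hc, Finset.mul_sum, mul_smul_comm]
  rw [Finset.sum_comm]
  simp only [← Finset.smul_sum, ← map_mul, ← map_sum, hp, AlgHom.commutes]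
  conv_rhs => rw [← hzig x]
  simp [map_sum, Algebra.smul_def, mul_comm]

/-- The tensor automorphism of `ω ⊗ R` defined by a homomorphism from the ring of coefficients. -/
def autOfAlgHom (φ : CoefRing ω →ₐ[k] R) : tensorAut ω R where
  val X := (isUnit_endOfAlgHom φ X).unit
  property := by
    have := finite_obj ω
    refine ⟨fun {X Y} f ↦ comm_of_coef fun x η ↦ ?_, ?_, fun X Y ↦ ?_⟩
    · simp only [IsUnit.unit_spec, coef_endOfAlgHom]
      exact congrArg φ (CoefRing.mk_lin f x η)
    · refine comm_of_coef (a := 1) fun x η ↦ ?_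
      rw [IsUnit.unit_spec, coef_endOfAlgHom, coef_one]
      have hx : (ε ω.functor).hom x = x • ω.one := by
        rw [FibreFunctor.one, ← _root_.map_smul, smul_eq_mul, mul_one]
      have hη : η = η ω.one • ω.done := LinearMap.ext fun y ↦ by
        conv_lhs => rw [FibreFunctor.eq_done_smul_one y, _root_.map_smul]
        rw [LinearMap.smul_apply, smul_eq_mul, smul_eq_mul, mul_comm]
      rw [LinearMap.comp_apply, hx, CoefRing.mk_smul_left, _root_.map_smul η]
      conv_lhs => rw [hη, ← CoefRing.smul_mk, ← CoefRing.one_def]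
      rw [← smul_assoc, ← Algebra.algebraMap_eq_smul_one, AlgHom.commutes]
    · refine tensor_comm_of_coef (m := (Functor.Monoidal.μIso ω.functor X Y).toLinearEquiv)
        fun x y ξ η ↦ ?_
      simp only [IsUnit.unit_spec, coef_endOfAlgHom]
      rw [← map_mul, CoefRing.mk_mul_mk]
      rfl

lemma coef_autOfAlgHom (φ : CoefRing ω →ₐ[k] R) {X : C} (x : ω.functor.obj X)
    (ξ : Module.Dual k (ω.functor.obj X)) :
    coef ((autOfAlgHom φ).1 X).val x ξ = φ (CoefRing.mk x ξ) :=
  coef_endOfAlgHom φ x ξ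

variable (ω R) in
/-- Tensor automorphisms of `ω ⊗ R` are the same as homomorphisms from the ring of coefficients
to `R`. -/
def autEquiv : tensorAut ω R ≃ (CoefRing ω →ₐ[k] R) where
  toFun := algHomOfAut ω
  invFun := autOfAlgHom
  left_inv a := Subtype.ext <| funext fun X ↦ Units.ext <| by
    have := finite_obj ω X
    exact coef_ext fun x ξ ↦ coef_autOfAlgHom _ x ξ
  right_inv φ := AlgHom.ext fun p ↦ by
    induction p using CoefRing.ind with | h X x ξ =>
    exact coef_autOfAlgHom φ x ξ

variable (ω) in
/-- The ring of coefficients, as a `k`-algebra in the universe of `k`. -/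
def coefAlg [EssentiallySmall.{u} C] : CommAlgCat.{u} k := CommAlgCat.of k (Shrink.{u} (CoefRing ω))

variable [EssentiallySmall.{u} C]

variable (ω) in
/-- The isomorphism of `coefAlg ω` with the ring of coefficients. -/
def coefAlgEquiv : coefAlg ω ≃ₐ[k] CoefRing ω := Shrink.algEquiv k (CoefRing ω)

variable (ω) in
/-- The functor `Aut^⊗(ω ⊗ -)` is represented by the ring of coefficients. -/
def homEquivAut (R : CommAlgCat.{u} k) : (coefAlg ω ⟶ R) ≃ tensorAut ω R :=
  (⟨fun f ↦ f.hom, CommAlgCat.ofHom, fun _ ↦ rfl, fun _ ↦ rfl⟩ :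
    (coefAlg ω ⟶ R) ≃ (coefAlg ω →ₐ[k] R)).trans
    ((AlgEquiv.arrowCongr (coefAlgEquiv ω) AlgEquiv.refl).trans (autEquiv R ω).symm)

lemma coef_homEquivAut {R : CommAlgCat.{u} k} (f : coefAlg ω ⟶ R) {X : C} (x : ω.functor.obj X)
    (ξ : Module.Dual k (ω.functor.obj X)) :
    coef ((homEquivAut ω R f).1 X).val x ξ =
      f.hom ((coefAlgEquiv ω).symm (CoefRing.mk x ξ)) :=
  coef_autOfAlgHom _ x ξ

lemma homEquivAut_comp {R S : CommAlgCat.{u} k} (f : coefAlg ω ⟶ R) (g : R ⟶ S) :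
    homEquivAut ω S (f ≫ g) = (tensorAutFunctor ω).map g (homEquivAut ω R f) :=
  Subtype.ext <| funext fun X ↦ Units.ext <| by
    have := finite_obj ω X
    refine coef_ext fun x ξ ↦ ?_
    rw [coef_homEquivAut]
    refine Eq.trans ?_ (coef_extEnd g.hom ((homEquivAut ω R f).1 X).val x ξ).symm
    rw [coef_homEquivAut]
    rfl

variable (ω) in
/-- The group functor `Aut^⊗(ω ⊗ -)` is represented by the algebra of coefficients. -/
def tensorAutRepresentableBy : ((unopUnop (CommAlgCat.{u} k) ⋙ tensorAutFunctor ω) ⋙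
    CategoryTheory.forget GrpCat).RepresentableBy (Opposite.op (coefAlg ω)) where
  homEquiv {X} := (opEquiv _ _).trans (homEquivAut ω X.unop)
  homEquiv_comp f g := homEquivAut_comp g.unop f.unop

end Representability

/-! ### From representing algebras to affine group schemes -/

section Scheme

open AlgebraicGeometry

variable {k : Type u} [Field k]

instance : (algSpec (CommRingCat.of k)).Braided := braidedAlgSpec

/-- The affine group scheme attached to a representable group functor. -/
def AffineGroupScheme.ofRepresentableBy {A : CommAlgCat.{u} k} (F : CommAlgCat.{u} k ⥤ GrpCat.{w})
    (r : ((unopUnop (CommAlgCat.{u} k) ⋙ F) ⋙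
      CategoryTheory.forget GrpCat).RepresentableBy (Opposite.op A)) : AffineGroupScheme k :=
  letI : GrpObj (Opposite.op A) := GrpObj.ofRepresentableBy _ (unopUnop (CommAlgCat.{u} k) ⋙ F) r
  { toGrp := (algSpec (CommRingCat.of k)).mapGrp.obj ⟨Opposite.op A⟩
    isAffine := inferInstanceAs (IsAffine (Spec _)) }

open MonObj CartesianMonoidalCategory
open scoped Obj

/-- The multiplication of `X` corresponds to the product of the two projections in `F(X ⊗ X)`; it is
pulled back along `lift f g`. -/
lemma representableBy_homEquiv_mul {D : Type*} [Category D] [CartesianMonoidalCategory D]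
    {X Y : D} (F : Dᵒᵖ ⥤ GrpCat.{w}) (r : (F ⋙ CategoryTheory.forget GrpCat).RepresentableBy X)
    (f g : Y ⟶ X) :
    letI := GrpObj.ofRepresentableBy X F r
    r.homEquiv (f * g) = ((r.homEquiv f * r.homEquiv g : F.obj (Opposite.op Y))) := by
  let α : ((F ⋙ forget₂ GrpCat MonCat) ⋙ CategoryTheory.forget MonCat).RepresentableBy X := r
  change α.homEquiv' (lift f g ≫ α.homEquiv'.symm (α.homEquiv' (fst X X) *
    α.homEquiv' (snd X X))) = α.homEquiv' f * α.homEquiv' g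
  simp only [α.homEquiv'_comp, Equiv.apply_symm_apply, map_mul]
  simp only [← α.homEquiv'_comp]
  simp

/-- `algSpec` is fully faithful and compatible with products, so the `R`-points of the spectrum of
`A` are the algebra maps `A → R`, with the group law transported from `F(R)`. -/
theorem AffineGroupScheme.nonempty_points_iso {A : CommAlgCat.{u} k}
    (F : CommAlgCat.{u} k ⥤ GrpCat.{max v u})
    (r : ((unopUnop (CommAlgCat.{u} k) ⋙ F) ⋙
      CategoryTheory.forget GrpCat).RepresentableBy (Opposite.op A)) :
    Nonempty ((AffineGroupScheme.ofRepresentableBy F r).points ⋙ GrpCat.uliftFunctor.{v} ≅ F) := by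
  let _ : GrpObj (Opposite.op A) :=
    GrpObj.ofRepresentableBy _ (unopUnop (CommAlgCat.{u} k) ⋙ F) r
  let hF := algSpec.fullyFaithful (R := CommRingCat.of k)
  let e : ∀ R : CommAlgCat.{u} k, (Opposite.op R ⟶ Opposite.op A) ≃* F.obj R := fun R ↦
    { toEquiv := r.homEquiv
      map_mul' := representableBy_homEquiv_mul _ r }
  refine ⟨NatIso.ofComponents (fun R ↦ MulEquiv.toGrpIso (MulEquiv.ulift.trans
    ((hF.homMulEquiv (X := Opposite.op R) (M := Opposite.op A)).symm.trans (e R)))) ?_⟩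
  intro R S f
  refine GrpCat.hom_ext (MonoidHom.ext fun ⟨g⟩ ↦ ?_)
  change r.homEquiv (hF.homEquiv.symm ((algSpec (CommRingCat.of k)).map f.op ≫ g)) =
    (F.map f).hom (r.homEquiv (hF.homEquiv.symm g))
  obtain ⟨g, rfl⟩ := hF.homEquiv.surjective g
  have h : (algSpec (CommRingCat.of k)).map f.op ≫ hF.homEquiv g = hF.homEquiv (f.op ≫ g) :=
    ((algSpec (CommRingCat.of k)).map_comp f.op g).symm
  rw [h, Equiv.symm_apply_apply, Equiv.symm_apply_apply]
  exact r.homEquiv_comp f.op g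

end Scheme

/-! ### Subspaces and linear maps that come from `C` -/

section Subobjects

open Limits

variable {k : Type u} [Field k] {C : Type v} [Category.{w} C] [Abelian C]
    [Linear k C] [MonoidalCategory C] [SymmetricCategory C]

lemma FibreFunctor.injective_lin (ω : FibreFunctor k C k) {X Y : C} (f : X ⟶ Y) [Mono f] :
    Function.Injective (ω.lin f) := by
  have := ω.preservesFiniteLimits
  exact (ModuleCat.mono_iff_injective (ω.functor.map f)).1 inferInstance

lemma FibreFunctor.surjective_lin (ω : FibreFunctor k C k) {X Y : C} (f : X ⟶ Y) [Epi f] :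
    Function.Surjective (ω.lin f) := by
  have := ω.preservesFiniteColimits
  exact (ModuleCat.epi_iff_surjective (ω.functor.map f)).1 inferInstance

lemma FibreFunctor.ker_lin_cokernel (ω : FibreFunctor k C k) {X Y : C} (f : X ⟶ Y) :
    LinearMap.ker (ω.lin (cokernel.π f)) = LinearMap.range (ω.lin f) := by
  have := ω.preservesFiniteColimits
  have := ω.additive
  have hS : (ShortComplex.mk _ _ (cokernel.condition f)).Exact :=
    ShortComplex.exact_of_g_is_cokernel _ (cokernelIsCokernel f)
  have hS' := hS.map_of_epi_of_preservesCokernel ω.functor (by dsimp; infer_instance) inferInstance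
  exact (ShortComplex.moduleCat_exact_iff_range_eq_ker _).1 hS' |>.symm

/-- A faithful functor reflects monomorphisms and epimorphisms, and an abelian category is balanced.
-/
lemma FibreFunctor.isIso_of_bijective [TensorialCategory k C] (ω : FibreFunctor k C k) {X Y : C}
    (f : X ⟶ Y) (h : Function.Bijective (ω.lin f)) : IsIso f := by
  have := ω.faithful
  have : IsIso (ω.functor.map f) := (ConcreteCategory.isIso_iff_bijective _).2 h
  exact isIso_of_reflects_iso f ω.functor

/-- A finite matrix of coefficients is given by vectors and linear forms on a single object. -/
lemma exists_common_coef {ι κ : Type} [Fintype ι] [Fintype κ] [DecidableEq ι] [DecidableEq κ]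
    {ω : FibreFunctor k C k} (c : ι → κ → CoefRing ω) : ∃ (Y : C) (y : ι → ω.functor.obj Y)
      (ζ : κ → Module.Dual k (ω.functor.obj Y)), ∀ i j, CoefRing.mk (y i) (ζ j) = c i j := by
  have hc : ∀ p : ι × κ, ∃ (X : C) (x : ω.functor.obj X) (ξ : Module.Dual k (ω.functor.obj X)),
      CoefRing.mk x ξ = c p.1 p.2 := fun p ↦ by
    induction c p.1 p.2 using CoefRing.ind with | h X x ξ => exact ⟨X, x, ξ, rfl⟩
  choose X x ξ hc using hc
  have := Abelian.hasFiniteBiproducts (C := C)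
  -- The summands are indexed by pairs. The vector for `i` lives on row `i` and the form for `j` on
  -- column `j`, so they meet only in the summand `(i, j)`.
  refine ⟨⨁ X, fun i ↦ ∑ j, ω.lin (biproduct.ι X (i, j)) (x (i, j)),
    fun j ↦ ∑ i, ξ (i, j) ∘ₗ ω.lin (biproduct.π X (i, j)), fun i j ↦ ?_⟩
  rw [← CoefRing.mkBilin_apply]
  simp only [map_sum, LinearMap.sum_apply, CoefRing.mkBilin_apply, CoefRing.mk_lin, LinearMap.comp_assoc,
    ← ω.lin_comp]
  rw [Finset.sum_eq_single i, Finset.sum_eq_single j]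
  · simp [hc]
  · intro j' _ hj
    rw [biproduct.ι_π_ne _ (by simp [hj])]
    simp
  · simp
  · intro i' _ hi
    refine Finset.sum_eq_zero fun j' _ ↦ ?_
    rw [biproduct.ι_π_ne _ (by simp [hi.symm])]
    simp
  · simp

variable [TensorialCategory k C] (ω : FibreFunctor k C k)

/-- A subspace of `ω(X)` comes from a subobject of `X` as soon as the coefficients of its vectors
at the linear forms vanishing on it are zero. -/
lemma exists_mono_range_eq {X : C} (W : Submodule k (ω.functor.obj X))
    (hW : ∀ x ∈ W, ∀ ξ : Module.Dual k (ω.functor.obj X), W ≤ LinearMap.ker ξ →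
      CoefRing.mk x ξ = 0) :
    ∃ (Z : C) (f : Z ⟶ X), Mono f ∧ LinearMap.range (ω.lin f) = W := by
  have := finite_obj ω X
  let P : Submodule k (ω.functor.obj X) → Prop := fun U ↦
    ∃ (Z : C) (f : Z ⟶ X), LinearMap.range (ω.lin f) = U
  have hinf : ∀ {U V}, P U → P V → P (U ⊓ V) := by
    rintro _ _ ⟨Z, f, rfl⟩ ⟨Z', f', rfl⟩
    refine ⟨_, pullback.fst f f' ≫ f, le_antisymm (le_inf ?_ ?_) ?_⟩
    · rw [ω.lin_comp]; exact LinearMap.range_comp_le_range _ _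
    · rw [pullback.condition, ω.lin_comp]; exact LinearMap.range_comp_le_range _ _
    · rintro _ ⟨⟨z, rfl⟩, z', h⟩
      obtain ⟨t, rfl, -⟩ := ω.exists_pullback f f' h.symm
      exact ⟨t, ω.lin_comp_apply _ _ _⟩
  have hsup : ∀ {U V}, P U → P V → P (U ⊔ V) := by
    rintro _ _ ⟨Z, f, rfl⟩ ⟨Z', f', rfl⟩
    refine ⟨Z ⊞ Z', biprod.desc f f', le_antisymm ?_ (sup_le ?_ ?_)⟩
    · rintro _ ⟨z, rfl⟩
      have : biprod.desc f f' = biprod.fst ≫ f + biprod.snd ≫ f' := by ext <;> simp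
      rw [this, ω.lin_add, ω.lin_comp, ω.lin_comp]
      exact Submodule.add_mem_sup ⟨_, rfl⟩ ⟨_, rfl⟩
    · have : f = biprod.inl ≫ biprod.desc f f' := by simp
      conv_lhs => rw [this, ω.lin_comp]
      exact LinearMap.range_comp_le_range _ _
    · have : f' = biprod.inr ≫ biprod.desc f f' := by simp
      conv_lhs => rw [this, ω.lin_comp]
      exact LinearMap.range_comp_le_range _ _
  -- A minimal subspace containing `x` among those coming from morphisms lies inside `W`.
  have hmem : ∀ x ∈ W, ∃ U, P U ∧ x ∈ U ∧ U ≤ W := fun x hx ↦ by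
    obtain ⟨U, ⟨hPU, hxU⟩, hmin⟩ := exists_minimal_of_wellFoundedLT (fun U ↦ P U ∧ x ∈ U)
      ⟨⊤, ⟨X, 𝟙 X, by simp⟩, trivial⟩
    refine ⟨U, hPU, hxU, fun y hy ↦ by_contra fun hyW ↦ ?_⟩
    obtain ⟨ξ, hξy, hξ⟩ := Submodule.exists_le_ker_of_notMem hyW
    -- The vanishing coefficient gives a morphism whose range contains `x` and lies in `ker ξ`. By
    -- minimality `U` lies in that range, against `ξ y ≠ 0`.
    obtain ⟨Z, z, f, hz, hf⟩ := CoefRing.mk_eq_zero_iff.1 (hW x hx ξ hξ)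
    obtain ⟨-, t, rfl⟩ := hmin ⟨hinf hPU ⟨Z, f, rfl⟩, hxU, z, hz⟩ inf_le_left hy
    exact hξy (LinearMap.congr_fun hf t)
  -- By stability under sums, a maximal such subspace of `W` absorbs all those given by `hmem`.
  obtain ⟨U, ⟨hPU, hUW⟩, hmax⟩ := exists_maximal_of_wellFoundedGT (fun U ↦ P U ∧ U ≤ W)
    ⟨⊥, ⟨X, 0, by simp⟩, bot_le⟩
  have hU : U = W := le_antisymm hUW fun x hx ↦ by
    obtain ⟨V, hV, hxV, hVW⟩ := hmem x hx
    exact hmax ⟨hsup hPU hV, sup_le hUW hVW⟩ le_sup_left (le_sup_right (a := U) hxV)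
  obtain ⟨Z, f, hf⟩ := hPU
  refine ⟨image f, image.ι f, inferInstance, ?_⟩
  rw [← hU, ← hf]
  conv_rhs => rw [← image.fac f, ω.lin_comp]
  exact (LinearMap.range_comp_of_range_eq_top _
    (LinearMap.range_eq_top.2 (ω.surjective_lin (factorThruImage f)))).symm

/-- A linear map that is compatible with matrix coefficients comes from a morphism. -/
lemma exists_lin_eq {X Y : C} (l : ω.functor.obj X →ₗ[k] ω.functor.obj Y)
    (hl : ∀ x η, CoefRing.mk (ω := ω) (l x) η = CoefRing.mk x (η ∘ₗ l)) :
    ∃ f : X ⟶ Y, ω.lin f = l := by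
  -- The graph of `l`. Compatibility with coefficients is what makes its range a subobject of `X ⊞
  -- Y`.
  let γ : ω.functor.obj X →ₗ[k] ω.functor.obj (X ⊞ Y) :=
    ω.lin biprod.inl + ω.lin biprod.inr ∘ₗ l
  have hfst : ∀ x, ω.lin biprod.fst (γ x) = x := fun x ↦ by
    simp [γ, ← ω.lin_comp_apply]
  have hsnd : ∀ x, ω.lin biprod.snd (γ x) = l x := fun x ↦ by
    simp [γ, ← ω.lin_comp_apply]
  obtain ⟨Z, f, _, hf⟩ := exists_mono_range_eq ω (LinearMap.range γ) (by
    rintro _ ⟨x, rfl⟩ ξ hξ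
    have h0 : ξ ∘ₗ γ = 0 := LinearMap.ext fun x ↦ hξ ⟨x, rfl⟩
    calc CoefRing.mk (γ x) ξ = CoefRing.mk x (ξ ∘ₗ γ) := by
          simp only [γ, LinearMap.add_apply, LinearMap.comp_apply, CoefRing.mk_add_left,
            LinearMap.comp_add, CoefRing.mk_add_right, CoefRing.mk_lin, hl, LinearMap.comp_assoc]
      _ = 0 := by rw [h0, CoefRing.mk_zero_right])
  have hZ : ∀ z, ∃ x, γ x = ω.lin f z := fun z ↦ by
    have : ω.lin f z ∈ LinearMap.range γ := hf ▸ ⟨z, rfl⟩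
    exact this
  -- The projection of the graph to `X` becomes bijective under `ω`, so it is an isomorphism; its
  -- inverse followed by the projection to `Y` is the required morphism.
  have hp : Function.Bijective (ω.lin (f ≫ biprod.fst)) := by
    constructor
    · refine (injective_iff_map_eq_zero _).2 fun z hz ↦ ?_
      obtain ⟨x, hx⟩ := hZ z
      rw [ω.lin_comp_apply, ← hx, hfst] at hz
      apply ω.injective_lin f
      rw [← hx, hz, map_zero, map_zero]
    · intro x
      obtain ⟨z, hz⟩ : γ x ∈ LinearMap.range (ω.lin f) := hf ▸ ⟨x, rfl⟩
      exact ⟨z, by rw [ω.lin_comp_apply, hz, hfst]⟩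
  have := ω.isIso_of_bijective _ hp
  refine ⟨inv (f ≫ biprod.fst) ≫ f ≫ biprod.snd, LinearMap.ext fun x ↦ ?_⟩
  obtain ⟨z, rfl⟩ := hp.2 x
  obtain ⟨x, hx⟩ := hZ z
  rw [← ω.lin_comp_apply, IsIso.hom_inv_id_assoc, ω.lin_comp_apply, ω.lin_comp_apply, ← hx, hfst,
    hsnd]

end Subobjects

/-! ### The equivalence with finite-dimensional representations -/

section Equivalence

open Limits

variable {k : Type u} [Field k] {C : Type v} [Category.{w} C] [Abelian C]
    [Linear k C] [MonoidalCategory C] [SymmetricCategory C] [TensorialCategory k C]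
    {ω : FibreFunctor k C k} {F : CommAlgCat.{u} k ⥤ GrpCat.{u}}
    (e : F ⋙ GrpCat.uliftFunctor.{v} ≅ tensorAutFunctor ω)

lemma repFunctor_faithful : (repFunctor ω e.hom).Faithful where
  map_injective {X Y} f g h := by
    have := ω.faithful
    exact ω.functor.map_injective (congrArg (fun t ↦ LinRep.Hom.hom t.hom) h)

variable [EssentiallySmall.{u} C]

/-- The generic element of `F`, which corresponds to the universal tensor automorphism. -/
def genericPoint : F.obj (coefAlg ω) :=
  ((e.inv.app (coefAlg ω)).hom (homEquivAut ω (coefAlg ω) (𝟙 _))).down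

lemma hom_app_genericPoint : (e.hom.app (coefAlg ω)).hom (ULift.up (genericPoint e)) =
    homEquivAut ω (coefAlg ω) (𝟙 _) :=
  ConcreteCategory.congr_hom (e.inv_hom_id_app (coefAlg ω)) (homEquivAut ω (coefAlg ω) (𝟙 _))

/-- Every element of `F(R)` is a specialization of the generic element. -/
lemma exists_map_genericPoint {R : CommAlgCat.{u} k} (g : F.obj R) :
    ∃ f : coefAlg ω ⟶ R, F.map f (genericPoint e) = g := by
  obtain ⟨f, hf⟩ := (homEquivAut ω R).surjective ((e.hom.app R).hom (ULift.up g))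
  refine ⟨f, ?_⟩
  have h := ConcreteCategory.congr_hom (e.hom.naturality f) (ULift.up (genericPoint e))
  have h1 : (tensorAutFunctor ω).map f (homEquivAut ω (coefAlg ω) (𝟙 _)) =
      homEquivAut ω R f := by
    rw [← homEquivAut_comp, Category.id_comp]
  have h2 : (e.hom.app R).hom (ULift.up (F.map f (genericPoint e))) =
      (e.hom.app R).hom (ULift.up g) :=
    h.trans ((congrArg ((tensorAutFunctor ω).map f).hom (hom_app_genericPoint e)).trans
      (h1.trans hf))
  have h3 : ∀ x, (e.inv.app R).hom ((e.hom.app R).hom x) = x :=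
    fun x ↦ ConcreteCategory.congr_hom (e.hom_inv_id_app R) x
  exact congrArg ULift.down ((h3 _).symm.trans ((congrArg (e.inv.app R).hom h2).trans (h3 _)))

/-- A linear map is a morphism of representations if it commutes with the action of the generic
element. -/
lemma comm_of_genericPoint {V W : LinRep F} (h : V.V →ₗ[k] W.V)
    (hg : W.act (genericPoint e) ∘ₗ h.baseChange (coefAlg ω) =
      h.baseChange (coefAlg ω) ∘ₗ V.act (genericPoint e)) {R : CommAlgCat.{u} k} (g : F.obj R) :
    W.act g ∘ₗ h.baseChange R = h.baseChange R ∘ₗ V.act g := by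
  obtain ⟨f, rfl⟩ := exists_map_genericPoint e g
  rw [LinRep.act_map, LinRep.act_map]
  exact extEnd_comm_baseChange f.hom h hg

/-- On `ω(X)` the generic point acts through the universal matrix. This translates equivariance into
identities in `CoefRing ω`. -/
lemma coef_repObj (X : C) (x : ω.functor.obj X) (ξ : Module.Dual k (ω.functor.obj X)) :
    coef ((repObj ω e.hom X).act (genericPoint e)) x ξ =
      (coefAlgEquiv ω).symm (CoefRing.mk x ξ) := by
  have h : (repObj ω e.hom X).act (genericPoint e) =
      ((homEquivAut ω (coefAlg ω) (𝟙 _)).1 X).val := by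
    rw [← hom_app_genericPoint e]
    rfl
  exact (congrArg (fun a ↦ coef a x ξ) h).trans (coef_homEquivAut (𝟙 _) x ξ)

/-- The matrix coefficients of a representation form a matrix coalgebra. -/
lemma exists_comul : ∃ Δ : coefAlg ω →ₐ[k] coefAlg ω ⊗[k] coefAlg ω,
    ∀ (V : LinRep F) {ι : Type} [Fintype ι] (b : Module.Basis ι k V.V) (x : V.V)
      (ξ : Module.Dual k V.V), Δ (coef (V.act (genericPoint e)) x ξ) =
        ∑ i, coef (V.act (genericPoint e)) x (b.coord i) ⊗ₜ[k]
          coef (V.act (genericPoint e)) (b i) ξ := by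
  let i₁ : coefAlg ω ⟶ CommAlgCat.of k (coefAlg ω ⊗[k] coefAlg ω) :=
    CommAlgCat.ofHom (Algebra.TensorProduct.includeLeft (R := k) (S := k) (A := coefAlg ω)
      (B := coefAlg ω))
  let i₂ : coefAlg ω ⟶ CommAlgCat.of k (coefAlg ω ⊗[k] coefAlg ω) :=
    CommAlgCat.ofHom (Algebra.TensorProduct.includeRight (R := k) (A := coefAlg ω)
      (B := coefAlg ω))
  -- `Δ` specializes the generic point to a product of its two copies. The copy from `i₁` acts
  -- first, so by `coef_mul` it supplies the left tensor factors.
  obtain ⟨Δ, hΔ⟩ := exists_map_genericPoint e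
    (F.map i₂ (genericPoint e) * F.map i₁ (genericPoint e))
  refine ⟨Δ.hom, fun V ι _ b x ξ ↦ ?_⟩
  have hmul : V.act (F.map i₂ (genericPoint e) * F.map i₁ (genericPoint e)) =
      V.act (F.map i₂ (genericPoint e)) * V.act (F.map i₁ (genericPoint e)) :=
    congrArg Units.val (map_mul (V.ρ.app _).hom _ _)
  rw [← coef_extEnd, ← LinRep.act_map, hΔ, hmul, coef_mul _ _ b]
  refine Finset.sum_congr rfl fun i _ ↦ ?_
  rw [LinRep.act_map, LinRep.act_map, coef_extEnd, coef_extEnd]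
  change (coef (V.act (genericPoint e)) x (b.coord i) ⊗ₜ[k] (1 : coefAlg ω)) *
    ((1 : coefAlg ω) ⊗ₜ[k] coef (V.act (genericPoint e)) (b i) ξ) = _
  rw [Algebra.TensorProduct.tmul_mul_tmul, mul_one, one_mul]

/-- The matrix coefficients of a representation at the unit element. -/
lemma exists_counit : ∃ ε : coefAlg ω →ₐ[k] k, ∀ (V : LinRep F) (x : V.V)
    (ξ : Module.Dual k V.V), ε (coef (V.act (genericPoint e)) x ξ) = ξ x := by
  -- The counit specializes the generic point to the identity of `F(k)`.
  obtain ⟨ε, hε⟩ := exists_map_genericPoint e (1 : F.obj (CommAlgCat.of k k))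
  refine ⟨ε.hom, fun V x ξ ↦ ?_⟩
  have hone : V.act (1 : F.obj (CommAlgCat.of k k)) = 1 :=
    congrArg Units.val (map_one (V.ρ.app _).hom)
  rw [← coef_extEnd, ← LinRep.act_map, hε, hone, coef_one]
  rfl

/-- Commuting with the generic point is exactly the compatibility with coefficients required by
`exists_lin_eq`. -/
lemma repFunctor_full : (repFunctor ω e.hom).Full where
  map_surjective {X Y} h := by
    obtain ⟨f, hf⟩ := exists_lin_eq ω (LinRep.Hom.hom h.hom).hom fun x η ↦
      (coefAlgEquiv ω).symm.injective <| by
        rw [← coef_repObj e, ← coef_repObj e]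
        exact coef_comm (h.hom.comm (genericPoint e)) x η
    exact ⟨f, ObjectProperty.hom_ext _ (LinRep.hom_ext (ModuleCat.hom_ext hf))⟩

/-- A quotient of a representation `ω(M)` is in the essential image. -/
lemma exists_iso_of_surjective {V : Repf F} {M : C} (s : (repFunctor ω e.hom).obj M ⟶ V)
    (hs : Function.Surjective (LinRep.Hom.hom s.hom).hom) :
    ∃ Q : C, Nonempty ((repFunctor ω e.hom).obj Q ≅ V) := by
  let l : ω.functor.obj M →ₗ[k] V.obj.V := (LinRep.Hom.hom s.hom).hom
  have hl : ∀ x ν, coef (V.obj.act (genericPoint e)) (l x) ν =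
      (coefAlgEquiv ω).symm (CoefRing.mk x (ν ∘ₗ l)) := fun x ν ↦ by
    rw [← coef_repObj e]
    exact coef_comm (s.hom.comm (genericPoint e)) x ν
  -- A form vanishing on `ker l` is `ν ∘ l`, and the coefficient of `x` at it is that of `l x = 0`
  -- at `ν`. So `ker l` is a subobject, and `V` is the image of its cokernel.
  obtain ⟨N, j, _, hj⟩ := exists_mono_range_eq ω (LinearMap.ker l) fun x hx ξ hξ ↦ by
    obtain ⟨ν, rfl⟩ : ξ ∈ LinearMap.range l.dualMap := by
      rw [LinearMap.range_dualMap_eq_dualAnnihilator_ker, Submodule.mem_dualAnnihilator]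
      exact fun w hw ↦ hξ hw
    apply (coefAlgEquiv ω).symm.injective
    refine (hl x ν).symm.trans ?_
    rw [LinearMap.mem_ker.1 hx, map_zero, ← coefBilin_apply, map_zero, LinearMap.zero_apply]
  have hker : LinearMap.ker (ω.lin (cokernel.π j)) = LinearMap.ker l := by
    rw [ω.ker_lin_cokernel, hj]
  let t : ω.functor.obj (cokernel j) ≃ₗ[k] V.obj.V :=
    ((ω.lin (cokernel.π j)).quotKerEquivOfSurjective (ω.surjective_lin _)).symm.trans
      ((Submodule.quotEquivOfEq _ _ hker).trans (l.quotKerEquivOfSurjective hs))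
  have ht : ∀ x, t (ω.lin (cokernel.π j) x) = l x := fun x ↦ by
    have : ω.lin (cokernel.π j) x = (ω.lin (cokernel.π j)).quotKerEquivOfSurjective
        (ω.surjective_lin _) (Submodule.Quotient.mk x) := rfl
    rw [this]
    simp only [t, LinearEquiv.trans_apply, LinearEquiv.symm_apply_apply]
    rfl
  refine ⟨cokernel j, ⟨ObjectProperty.isoMk _ (LinRep.isoMk (X := repObj ω e.hom (cokernel j))
    t.toModuleIso fun g ↦ comm_of_genericPoint e (V := repObj ω e.hom (cokernel j)) _ ?_ g)⟩⟩
  have : Module.Finite k V.obj.V := V.property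
  refine comm_of_coef fun y ν ↦ ?_
  obtain ⟨x, rfl⟩ := ω.surjective_lin (cokernel.π j) y
  refine (congrArg (coef (V.obj.act (genericPoint e)) · ν) (ht x)).trans ((hl x ν).trans ?_)
  refine Eq.trans ?_ (coef_repObj e (cokernel j) _ _).symm
  exact congrArg (coefAlgEquiv ω).symm ((congrArg (CoefRing.mk x)
    (LinearMap.ext fun x ↦ congrArg ν (ht x).symm)).trans
      (CoefRing.mk_lin (cokernel.π j) x (ν ∘ₗ t.toLinearMap)).symm)

/-- Every finite-dimensional representation is a quotient of a representation `ω(M)`. -/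
lemma exists_surjective (V : Repf F) : ∃ (M : C) (s : (repFunctor ω e.hom).obj M ⟶ V),
    Function.Surjective (LinRep.Hom.hom s.hom).hom := by
  have : Module.Finite k V.obj.V := V.property
  obtain ⟨Δ, hΔ⟩ := exists_comul e
  obtain ⟨ε, hε⟩ := exists_counit e
  let b := Module.finBasis k V.obj.V
  let c := coefBilin (V.obj.act (genericPoint e))
  -- The whole matrix of `V` at the generic point is realized on one object `Y`.
  obtain ⟨Y, y, ζ, hy⟩ := exists_common_coef fun i j ↦
    coefAlgEquiv ω (c (b i) (b.coord j))
  have := finite_obj ω Y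
  let d : ω.functor.obj Y →ₗ[k] Module.Dual k (ω.functor.obj Y) →ₗ[k] coefAlg ω :=
    coefBilin ((repObj ω e.hom Y).act (genericPoint e))
  have hd : ∀ x ξ, d x ξ = (coefAlgEquiv ω).symm (CoefRing.mk x ξ) := coef_repObj e Y
  let s : ω.functor.obj Y →ₗ[k] V.obj.V := ∑ j, (ζ j).smulRight (b j)
  have hsζ : ∀ j, b.coord j ∘ₗ s = ζ j := fun j ↦ LinearMap.ext fun x ↦ by
    simp [s, Finsupp.single_apply]
  -- `D` measures the failure of `s` to commute with the generic point; `s` is equivariant on `ker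
  -- D`.
  let D : ω.functor.obj Y →ₗ[k] (Fin (Module.finrank k V.obj.V) → coefAlg ω) :=
    LinearMap.pi fun j ↦ d.flip (b.coord j ∘ₗ s) - c.flip (b.coord j) ∘ₗ s
  have hD : ∀ x j, D x j = d x (b.coord j ∘ₗ s) - c (s x) (b.coord j) := fun _ _ ↦ rfl
  have hW : ∀ x ∈ LinearMap.ker D, ∀ ν : Module.Dual k V.obj.V, d x (ν ∘ₗ s) = c (s x) ν := by
    intro x hx ν
    have h1 : ∀ j, d x (b.coord j ∘ₗ s) = c (s x) (b.coord j) := fun j ↦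
      sub_eq_zero.1 (congrFun (LinearMap.mem_ker.1 hx) j)
    have h2 : d x ∘ₗ s.dualMap = c (s x) := b.dualBasis.ext fun j ↦ by
      rw [b.coe_dualBasis]; exact h1 j
    exact LinearMap.congr_fun h2 ν
  let a := Module.finBasis k (ω.functor.obj Y)
  have hda : ∀ x (ξ : Module.Dual k (ω.functor.obj Y)), d x ξ = ∑ i, ξ (a i) • d x (a.coord i) :=
    fun x ξ ↦ by
      conv_lhs => rw [← a.sum_dual_apply_smul_coord ξ, map_sum]
      simp only [_root_.map_smul]
  -- Stability of `ker D`: the two halves of the sum are values of `Δ`, computed in `ω(Y)` and in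
  -- `V`, and their arguments agree because `D x = 0`.
  have hT : ∀ x ∈ LinearMap.ker D, ∀ j, ∑ i, d x (a.coord i) ⊗ₜ[k] D (a i) j = 0 := by
    intro x hx j
    have h1 : ∑ i, d x (a.coord i) ⊗ₜ[k] d (a i) (b.coord j ∘ₗ s) = Δ (d x (b.coord j ∘ₗ s)) :=
      (hΔ (repObj ω e.hom Y) a x _).symm
    have h2 : ∀ i, c (s (a i)) (b.coord j) =
        ∑ l, (b.coord l ∘ₗ s) (a i) • c (b l) (b.coord j) := fun i ↦ by
      conv_lhs => rw [← b.sum_repr (s (a i)), map_sum, LinearMap.sum_apply]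
      simp
    have h3 : ∑ i, d x (a.coord i) ⊗ₜ[k] c (s (a i)) (b.coord j) =
        Δ (d x (b.coord j ∘ₗ s)) := by
      rw [hW x hx]
      refine Eq.trans ?_ (hΔ V.obj b (s x) (b.coord j)).symm
      simp only [h2, TensorProduct.tmul_sum]
      rw [Finset.sum_comm]
      refine Finset.sum_congr rfl fun l _ ↦ ?_
      change _ = c (s x) (b.coord l) ⊗ₜ[k] c (b l) (b.coord j)
      rw [← hW x hx, hda x, TensorProduct.sum_tmul]
      simp only [TensorProduct.smul_tmul]
    simp only [hD, TensorProduct.tmul_sub, Finset.sum_sub_distrib, h1, h3, sub_self]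
  -- A form vanishing on `ker D` is `ψ ∘ D`. Applying the components of `ψ` to the right factors in
  -- `hT` shows that its coefficient at `x` is zero.
  obtain ⟨M, i, _, hi⟩ := exists_mono_range_eq ω (LinearMap.ker D) fun x hx ξ hξ ↦ by
    obtain ⟨ψ, rfl⟩ : ξ ∈ LinearMap.range D.dualMap := by
      rw [LinearMap.range_dualMap_eq_dualAnnihilator_ker, Submodule.mem_dualAnnihilator]
      exact fun w hw ↦ hξ hw
    apply (coefAlgEquiv ω).symm.injective
    rw [← hd, map_zero, hda]
    have hψ : ∀ i, (D.dualMap ψ) (a i) =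
        ∑ j, (ψ ∘ₗ LinearMap.single k _ j) (D (a i) j) := fun i ↦ by
      rw [LinearMap.dualMap_apply]
      conv_lhs => rw [← Finset.univ_sum_single (D (a i)), map_sum]
      rfl
    simp only [hψ, Finset.sum_smul]
    rw [Finset.sum_comm]
    refine Finset.sum_eq_zero fun j _ ↦ ?_
    have h := congrArg (TensorProduct.rid k (coefAlg ω) ∘
      LinearMap.lTensor (coefAlg ω) (ψ ∘ₗ LinearMap.single k _ j)) (hT x hx j)
    simpa only [Function.comp_apply, map_sum, LinearMap.lTensor_tmul, TensorProduct.rid_tmul,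
      map_zero] using h
  have hWM : ∀ m, ω.lin i m ∈ LinearMap.ker D := fun m ↦ hi ▸ ⟨m, rfl⟩
  refine ⟨M, ObjectProperty.homMk (X := (repFunctor ω e.hom).obj M)
    { hom := ModuleCat.ofHom (s ∘ₗ ω.lin i)
      comm := fun g ↦ comm_of_genericPoint e (V := repObj ω e.hom M) _ ?_ g }, ?_⟩
  · refine comm_of_coef fun m ν ↦ ?_
    refine Eq.trans ?_ (coef_repObj e M _ _).symm
    refine (hW _ (hWM m) ν).symm.trans ((hd _ _).trans (congrArg _ ?_))
    exact CoefRing.mk_lin i m (ν ∘ₗ s)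
  -- The coefficient of `y j` at `ζ l` equals that of `b j` at `b.coord l`, and the counit evaluates
  -- both.
  · have hsy : ∀ j, s (y j) = b j := fun j ↦ b.ext_elem fun l ↦ by
      have h1 := hε (repObj ω e.hom Y) (y j) (ζ l)
      have h2 := hε V.obj (b j) (b.coord l)
      have h3 := congrArg (coefAlgEquiv ω).symm (hy j l)
      rw [AlgEquiv.symm_apply_apply, ← hd] at h3
      have h4 : ζ l (y j) = b.coord l (b j) := h1.symm.trans ((congrArg ε h3).trans h2)
      rw [← hsζ] at h4
      exact h4
    -- By the choice of `Y` and `s`, the two terms of `D (y j)` are the same matrix entry. So `ker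
    -- D` contains the preimages `y j` of a basis of `V`.
    have hyD : ∀ j, y j ∈ LinearMap.range (ω.lin i) := fun j ↦ by
      rw [hi, LinearMap.mem_ker]
      funext l
      rw [hD, hsζ, hsy, hd, hy, AlgEquiv.symm_apply_apply, sub_self]
      rfl
    change Function.Surjective (s ∘ₗ ω.lin i)
    rw [← LinearMap.range_eq_top, eq_top_iff, ← b.span_eq, Submodule.span_le]
    rintro _ ⟨j, rfl⟩
    obtain ⟨m, hm⟩ := hyD j
    exact ⟨m, by rw [LinearMap.comp_apply, hm, hsy]⟩

lemma repFunctor_isEquivalence : (repFunctor ω e.hom).IsEquivalence where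
  faithful := repFunctor_faithful e
  full := repFunctor_full e
  essSurj := ⟨fun V ↦ by
    obtain ⟨M, s, hs⟩ := exists_surjective e V
    obtain ⟨Q, ⟨i⟩⟩ := exists_iso_of_surjective e s hs
    exact ⟨Q, ⟨i⟩⟩⟩

end Equivalence

end

end NeutralTannaka

theorem mainTheorem1 (k : Type u) [Field k] (C : Type v) [Category.{w} C] [Abelian C]
    [Linear k C] [MonoidalCategory C] [SymmetricCategory C] [TannakianCategory k C]
    [EssentiallySmall.{u} C] (ω : FibreFunctor k C k) :
    (∃ G : AffineGroupScheme k,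
      Nonempty (G.points ⋙ GrpCat.uliftFunctor.{v} ≅ tensorAutFunctor ω)) ∧
    ∀ (G : AffineGroupScheme k)
      (e : G.points ⋙ GrpCat.uliftFunctor.{v} ≅ tensorAutFunctor ω),
      IsTensorEquivalence (repFunctor ω e.hom) :=
  ⟨⟨_, AffineGroupScheme.nonempty_points_iso (tensorAutFunctor ω) (tensorAutRepresentableBy ω)⟩,
    fun _ e ↦ repFunctor_isEquivalence e⟩
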